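/- **Theorem 1 (Rates of convergence under Frobenius norm).** For each sample size $n$ let $p=p_n\ge K=K_n\ge 1$ be integers, and let $\mathbf y=\mathbf B_n\mathbf f+\boldsymbol\varepsilon$ with $\mathbf f$ a random vector in $\mathbb R^K$, $\mathbf y,\boldsymbol\varepsilon$ random vectors in $\mathbb R^p$ and $\mathbf B_n$ a deterministic $p\times K$ matrix (the laws may depend on $n$). Put $\mathbf\Sigma=\mathbf\Sigma_n=\mathrm{cov}(\mathbf y)$. Assume: (A) $(\mathbf f_1,\mathbf y_1),\dots,(\mathbf f_n,\mathbf y_n)$ are i.i.d. copies of $(\mathbf f,\mathbf y)$; $E(\boldsymbol\varepsilon\mid\mathbf f)=\mathbf 0$ and $\mathrm{cov}(\boldsymbol\varepsilon\mid\mathbf f)=\mathbf\Sigma_{n,0}$ is a deterministic diagonal matrix; the distribution of $\mathbf f$ is continuous, that is, $P(\mathbf f=\mathbf v)=0$ for every $\mathbf v\in\mathbb R^K$. (B) The components of $\mathbf f$ and $\boldsymbol\varepsilon$ have finite fourth moments, $E\|\mathbf y\|^2=O(p)$, the sequences $c_n=\max_{1\le i\le K}E f_i^4$ and $d_n=\max_{1\le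 i\le p}E\varepsilon_i^4$ are bounded, and there is a constant $\sigma_1>0$ such that the smallest eigenvalue of $\mathrm{cov}(\mathbf f)$ is at least $\sigma_1$ for all $n$. Let $\mathbf X=(\mathbf f_1,\dots,\mathbf f_n)$, $\mathbf Y=(\mathbf y_1,\dots,\mathbf y_n)$, $\mathbf 1=(1,\dots,1)'\in\mathbb R^n$, $\widehat{\mathbf B}=\mathbf Y\mathbf X'(\mathbf X\mathbf X')^{-1}$ (with the convention that $(\mathbf X\mathbf X')^{-1}$ is read as $\mathbf 0$ when $\mathbf X\mathbf X'$ is singular), $\widehat{\mathbf E}=\mathbf Y-\widehat{\mathbf B}\mathbf X$, $$\widehat{\mathrm{cov}}(\mathbf f)=\frac{1}{n-1}\mathbf X\mathbf X'-\frac{1}{n(n-1)}\mathbf X\mathbf 1\mathbf 1'\mathbf X',\qquad \widehat{\mathbf\Sigma}=\widehat{\mathbf B}\,\widehat{\mathrm{cov}}(\mathbf f)\,\widehat{\mathbf B}'+\mathrm{diag}\bigl(n^{-1}\widehat{\mathbf E}\widehat{\mathbf E}'\bigr),$$ $$\widehat{\mathbf\Sigma}_{\mathrm{sam}}=\frac{1}{n-1}\mathbf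 Y\mathbf Y'-\frac{1}{n(n-1)}\mathbf Y\mathbf 1\mathbf 1'\mathbf Y'.$$ Here $\mathrm{diag}(\mathbf M)$ denotes the diagonal part of $\mathbf M$. Write $\|\mathbf M\|_F=\{\mathrm{tr}(\mathbf M\mathbf M')\}^{1/2}$ and let $\lambda_1(\mathbf M)\ge\dots\ge\lambda_p(\mathbf M)$ be the eigenvalues of a symmetric $p\times p$ matrix $\mathbf M$. Then, as $n\to\infty$, $$\|\widehat{\mathbf\Sigma}-\mathbf\Sigma\|_F=O_P(n^{-1/2}pK),\qquad \|\widehat{\mathbf\Sigma}_{\mathrm{sam}}-\mathbf\Sigma\|_F=O_P(n^{-1/2}pK),$$ $$\max_{1\le k\le p}|\lambda_k(\widehat{\mathbf\Sigma})-\lambda_k(\mathbf\Sigma)|=o_P\{(p^2K^2\log n/n)^{1/2}\},\qquad \max_{1\le k\le p}|\lambda_k(\widehat{\mathbf\Sigma}_{\mathrm{sam}})-\lambda_k(\mathbf\Sigma)|=o_P\{(p^2K^2\log n/n)^{1/2}\}.$$ -/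

import Mathlib

open MeasureTheory ProbabilityTheory Filter Matrix

noncomputable section

namespace FactorCov

/-- Frobenius norm `{tr(A Aᵀ)}^{1/2}`. -/
def frobNorm {q r : ℕ} (A : Matrix (Fin q) (Fin r) ℝ) : ℝ :=
  Real.sqrt (A * Aᵀ).trace

/-- The eigenvalues of a real symmetric matrix, with multiplicity, in decreasing order
(`Fin q` is zero-based: `lam hA 0` is the largest one). -/
def lam {q : ℕ} {A : Matrix (Fin q) (Fin q) ℝ} (hA : A.IsHermitian) (k : Fin q) : ℝ :=
  hA.eigenvalues₀ (Fin.cast (Fintype.card_fin q).symm k)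

theorem lam_antitone {q : ℕ} {A : Matrix (Fin q) (Fin q) ℝ} (hA : A.IsHermitian) :
    Antitone (lam hA) := fun _ _ hij => hA.eigenvalues₀_antitone hij

/-- `max_k |λ_k(A) - λ_k(A')|`. -/
def maxEigDist {q : ℕ} {A A' : Matrix (Fin q) (Fin q) ℝ}
    (hA : A.IsHermitian) (hA' : A'.IsHermitian) : ℝ :=
  ⨆ k : Fin q, |lam hA k - lam hA' k|

section Population

variable {Ω : Type*} [MeasurableSpace Ω]

/-- Covariance matrix of a random vector. -/
def covMat {q : ℕ} (P : Measure Ω) (Z : Ω → Fin q → ℝ) : Matrix (Fin q) (Fin q) ℝ :=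
  Matrix.of fun i j => cov[fun ω => Z ω i, fun ω => Z ω j; P]

theorem covMat_isHermitian {q : ℕ} (P : Measure Ω) (Z : Ω → Fin q → ℝ) :
    (covMat P Z).IsHermitian := by
  ext i j
  simp [covMat, covariance_comm]

/-- Conditional covariance of two real random variables given a sub-σ-algebra. -/
def condCov (P : Measure Ω) (m : MeasurableSpace Ω) (U V : Ω → ℝ) : Ω → ℝ :=
  P[fun ω => (U ω - (P[U | m]) ω) * (V ω - (P[V | m]) ω) | m]

/-- The idiosyncratic error `ε = y - B f` in the factor model `y = B f + ε`. -/
def err {p K : ℕ} (B : Matrix (Fin p) (Fin K) ℝ) (f : Ω → Fin K → ℝ) (y : Ω → Fin p → ℝ) :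
    Ω → Fin p → ℝ :=
  fun ω => y ω - B *ᵥ f ω

end Population

section Estimators

variable {p K n : ℕ}

/-- Sample covariance matrix of the columns of `Z`:
`(n-1)⁻¹ Z Zᵀ - {n(n-1)}⁻¹ Z 1 1ᵀ Zᵀ`. -/
def sampleCov {q : ℕ} (Z : Matrix (Fin q) (Fin n) ℝ) : Matrix (Fin q) (Fin q) ℝ :=
  ((n : ℝ) - 1)⁻¹ • (Z * Zᵀ)
    - ((n : ℝ) * ((n : ℝ) - 1))⁻¹ • (Z * (Matrix.of fun _ _ => 1 : Matrix (Fin n) (Fin n) ℝ) * Zᵀ)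

/-- Least-squares estimator `Y Xᵀ (X Xᵀ)⁻¹` of the loading matrix. -/
def loadingHat (X : Matrix (Fin K) (Fin n) ℝ) (Y : Matrix (Fin p) (Fin n) ℝ) :
    Matrix (Fin p) (Fin K) ℝ :=
  Y * Xᵀ * (X * Xᵀ)⁻¹

/-- Residual matrix `Y - B̂ X`. -/
def residual (X : Matrix (Fin K) (Fin n) ℝ) (Y : Matrix (Fin p) (Fin n) ℝ) :
    Matrix (Fin p) (Fin n) ℝ :=
  Y - loadingHat X Y * X

/-- `diag(n⁻¹ Ê Êᵀ)`. -/
def errCovHat (X : Matrix (Fin K) (Fin n) ℝ) (Y : Matrix (Fin p) (Fin n) ℝ) :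
    Matrix (Fin p) (Fin p) ℝ :=
  Matrix.diagonal ((n : ℝ)⁻¹ • (residual X Y * (residual X Y)ᵀ)).diag

/-- Factor-model covariance estimator `B̂ côv(f) B̂ᵀ + Σ̂₀`. -/
def factorCov (X : Matrix (Fin K) (Fin n) ℝ) (Y : Matrix (Fin p) (Fin n) ℝ) :
    Matrix (Fin p) (Fin p) ℝ :=
  loadingHat X Y * sampleCov X * (loadingHat X Y)ᵀ + errCovHat X Y

theorem sampleCov_isHermitian {q : ℕ} (Z : Matrix (Fin q) (Fin n) ℝ) :
    (sampleCov Z).IsHermitian := by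
  have h : (Matrix.of fun (_ _ : Fin n) => (1 : ℝ))ᵀ = Matrix.of fun _ _ => (1 : ℝ) := rfl
  rw [Matrix.IsHermitian, conjTranspose_eq_transpose_of_trivial]
  simp [sampleCov, transpose_mul, h, Matrix.mul_assoc]

theorem factorCov_isHermitian (X : Matrix (Fin K) (Fin n) ℝ) (Y : Matrix (Fin p) (Fin n) ℝ) :
    (factorCov X Y).IsHermitian := by
  have h := sampleCov_isHermitian X
  rw [Matrix.IsHermitian, conjTranspose_eq_transpose_of_trivial] at h ⊢
  simp [factorCov, errCovHat, transpose_mul, h, Matrix.mul_assoc]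

/-- The data matrix whose columns are the observations. -/
def dataMatrix {Ω : Type*} {q : ℕ} (Z : Fin n → Ω → Fin q → ℝ) (ω : Ω) :
    Matrix (Fin q) (Fin n) ℝ :=
  Matrix.of fun i a => Z a ω i

end Estimators

/-- Condition (A) at a fixed sample size `n`. Here `(f, y)` is the population vector and
`(fs a, ys a)`, `a : Fin n`, are the observations. -/
structure ConditionA {Ω : Type*} [MeasurableSpace Ω] (P : Measure Ω) {n p K : ℕ}
    (B : Matrix (Fin p) (Fin K) ℝ) (S0 : Matrix (Fin p) (Fin p) ℝ)
    (f : Ω → Fin K → ℝ) (y : Ω → Fin p → ℝ)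
    (fs : Fin n → Ω → Fin K → ℝ) (ys : Fin n → Ω → Fin p → ℝ) : Prop where
  measurable_f : Measurable f
  measurable_y : Measurable y
  indep : iIndepFun (fun a ω => (fs a ω, ys a ω)) P
  ident : ∀ a, IdentDistrib (fun ω => (fs a ω, ys a ω)) (fun ω => (f ω, y ω)) P P
  condMean : ∀ i, P[fun ω => err B f y ω i | MeasurableSpace.comap f inferInstance] =ᵐ[P] 0
  condCov : ∀ i j, FactorCov.condCov P (MeasurableSpace.comap f inferInstance)
    (fun ω => err B f y ω i) (fun ω => err B f y ω j) =ᵐ[P] fun _ => S0 i j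
  diag : S0.IsDiag
  continuous : ∀ v, P {ω | f ω = v} = 0
  le : K ≤ p

/-- Condition (B), on the whole sequence of models. The first two fields say that the fourth
moments below are finite; the last one bounds all eigenvalues of `cov(f)`, hence the smallest. -/
structure ConditionB {Ω : ℕ → Type*} [∀ n, MeasurableSpace (Ω n)]
    (P : ∀ n, Measure (Ω n)) {p K : ℕ → ℕ}
    (B : ∀ n, Matrix (Fin (p n)) (Fin (K n)) ℝ)
    (f : ∀ n, Ω n → Fin (K n) → ℝ) (y : ∀ n, Ω n → Fin (p n) → ℝ) : Prop where
  memLp_f : ∀ n i, MemLp (fun ω => f n ω i) 4 (P n)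
  memLp_err : ∀ n i, MemLp (fun ω => err (B n) (f n) (y n) ω i) 4 (P n)
  b_bigO : (fun n => ∫ ω, ∑ i, (y n ω i) ^ 2 ∂(P n)) =O[atTop] fun n => (p n : ℝ)
  c_bdd : BddAbove (Set.range fun n => ⨆ i, ∫ ω, (f n ω i) ^ 4 ∂(P n))
  d_bdd : BddAbove (Set.range fun n => ⨆ i, ∫ ω, (err (B n) (f n) (y n) ω i) ^ 4 ∂(P n))
  eig_lower : ∃ σ₁ : ℝ, 0 < σ₁ ∧ ∀ n k, σ₁ ≤ lam (covMat_isHermitian (P n) (f n)) k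

/-- `X_n = O_P(r_n)`. -/
def IsBigOP {Ω : ℕ → Type*} [∀ n, MeasurableSpace (Ω n)] (P : ∀ n, Measure (Ω n))
    (X : ∀ n, Ω n → ℝ) (r : ℕ → ℝ) : Prop :=
  ∀ ε : ℝ, 0 < ε → ∃ M : ℝ, 0 < M ∧
    ∀ᶠ n in atTop, (P n).real {ω | M * r n < |X n ω|} < ε

/-- `X_n = o_P(r_n)`. -/
def IsLittleOP {Ω : ℕ → Type*} [∀ n, MeasurableSpace (Ω n)] (P : ∀ n, Measure (Ω n))
    (X : ∀ n, Ω n → ℝ) (r : ℕ → ℝ) : Prop :=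
  ∀ ε : ℝ, 0 < ε →
    Tendsto (fun n => (P n).real {ω | ε * r n < |X n ω|}) atTop (nhds 0)

end FactorCov

end

/-! Probability enters once, and everything else is deterministic matrix algebra. By independence,
each empirical moment of the factors and errors has mean squared Frobenius error of order (number of
entries)/n. `discrepancy` adds these errors, each divided by the square of its order, together with
the normalised sizes of Y and BX. Its expectation is at most 10C, so Markov's inequality puts all
seven quantities within a factor s of their order (`TypicalSample`) outside an event of probability
10C/s².

On a typical sample the bound for the sample covariance comes from expanding Y = BX + E, using ‖B‖²
= O(p). For the factor estimator, let Q = Xᵀ(XXᵀ)⁻¹X, so that B̂X = YQ. If K/√n is small, XXᵀ ≥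
(nσ/2)I. Then YQ = BX + EQ with ‖EQ‖² = O(pK), and all error terms are O(pK/√n). If K/√n is not
small, XXᵀ may be singular; but Q always contracts, hence ‖Σ̂‖ = O(p), which is already O(pK/√n).
This dichotomy (`norm_factorCov_sub_le`) removes any need to restrict the growth of K.

Eigenvalues follow from Weyl's inequality, the operator norm being at most the Frobenius norm. The
factor √(log n) → ∞ turns O_P into o_P. -/

noncomputable section

namespace FactorCov

/-! ### Weyl's inequality for ordered eigenvalues. -/

section Weyl

variable {E : Type*} [NormedAddCommGroup E] [InnerProductSpace ℝ E] [FiniteDimensional ℝ E]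

theorem inner_apply_self_eq_sum {n : ℕ} {T : E →ₗ[ℝ] E} (hT : T.IsSymmetric)
    (hn : Module.finrank ℝ E = n) (x : E) :
    inner ℝ (T x) x
      = ∑ i, hT.eigenvalues hn i * (inner ℝ (hT.eigenvectorBasis hn i) x) ^ 2 := by
  rw [← (hT.eigenvectorBasis hn).sum_inner_mul_inner]
  refine Finset.sum_congr rfl fun i _ => ?_
  rw [hT, hT.apply_eigenvectorBasis hn i, inner_smul_right, real_inner_comm]
  simp
  ring

theorem norm_sq_eq_sum_eigenvectorBasis {n : ℕ} {T : E →ₗ[ℝ] E} (hT : T.IsSymmetric)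
    (hn : Module.finrank ℝ E = n) (x : E) :
    ‖x‖ ^ 2 = ∑ i, (inner ℝ (hT.eigenvectorBasis hn i) x) ^ 2 := by
  rw [← real_inner_self_eq_norm_sq, ← (hT.eigenvectorBasis hn).sum_inner_mul_inner]
  refine Finset.sum_congr rfl fun i _ => ?_
  rw [real_inner_comm]
  ring

/-- Monotonicity of ordered eigenvalues under a bound between quadratic forms (Weyl). -/
theorem eigenvalues_le_add_of_inner_le {n : ℕ} {S T : E →ₗ[ℝ] E} (hS : S.IsSymmetric)
    (hT : T.IsSymmetric) (hn : Module.finrank ℝ E = n) {δ : ℝ}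
    (h : ∀ x, inner ℝ (S x) x ≤ inner ℝ (T x) x + δ * ‖x‖ ^ 2) (k : Fin n) :
    hS.eigenvalues hn k ≤ hT.eigenvalues hn k + δ := by
  let b := hS.eigenvectorBasis hn
  let c := hT.eigenvectorBasis hn
  -- The kernel of Φ is orthogonal to b_i for i > k and to c_i for i < k. These are n - 1 conditions
  -- in dimension n, so some x ≠ 0 satisfies them. Eigenvalues decrease, so on x the form of S is at
  -- least its k-th eigenvalue times ‖x‖² and that of T at most its own.
  let Φ : E →ₗ[ℝ] ({i : Fin n // i ≠ k} → ℝ) := LinearMap.pi fun i =>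
    if k < i.1 then (innerSL ℝ (b i.1)).toLinearMap else (innerSL ℝ (c i.1)).toLinearMap
  have hlt : Module.finrank ℝ ({i : Fin n // i ≠ k} → ℝ) < Module.finrank ℝ E := by
    rw [Module.finrank_fintype_fun_eq_card, hn]
    have := Fintype.card_subtype_lt (p := fun i : Fin n => i ≠ k) (x := k) (by simp)
    simpa using this
  obtain ⟨x, hx, hx0⟩ := (Submodule.ne_bot_iff _).1
    (LinearMap.ker_ne_bot_of_finrank_lt (f := Φ) hlt)
  have hΦ : ∀ i : {i : Fin n // i ≠ k}, Φ x i = 0 := fun i => by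
    rw [LinearMap.mem_ker.1 hx]; rfl
  have hb : ∀ i, k < i → inner ℝ (b i) x = 0 := fun i hi => by
    have := hΦ ⟨i, hi.ne'⟩
    simpa [Φ, hi] using this
  have hc : ∀ i, i < k → inner ℝ (c i) x = 0 := fun i hi => by
    have := hΦ ⟨i, hi.ne⟩
    simpa [Φ, hi.not_gt] using this
  have h1 : hS.eigenvalues hn k * ‖x‖ ^ 2 ≤ inner ℝ (S x) x := by
    rw [inner_apply_self_eq_sum hS hn, norm_sq_eq_sum_eigenvectorBasis hS hn, Finset.mul_sum]
    refine Finset.sum_le_sum fun i _ => ?_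
    rcases lt_or_ge k i with hi | hi
    · have := hb i hi
      simp only [b] at this
      simp [this]
    · exact mul_le_mul_of_nonneg_right (hS.eigenvalues_antitone hn hi) (sq_nonneg _)
  have h2 : inner ℝ (T x) x ≤ hT.eigenvalues hn k * ‖x‖ ^ 2 := by
    rw [inner_apply_self_eq_sum hT hn, norm_sq_eq_sum_eigenvectorBasis hT hn, Finset.mul_sum]
    refine Finset.sum_le_sum fun i _ => ?_
    rcases lt_or_ge i k with hi | hi
    · have := hc i hi
      simp only [c] at this
      simp [this]
    · exact mul_le_mul_of_nonneg_right (hT.eigenvalues_antitone hn hi) (sq_nonneg _)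
  have hpos : 0 < ‖x‖ ^ 2 := by positivity
  have := h x
  refine le_of_mul_le_mul_right (a := ‖x‖ ^ 2) ?_ hpos
  linarith

end Weyl

/-! ### The Frobenius norm, which ‖·‖ denotes for matrices from here on. -/

open scoped Matrix.Norms.Frobenius

section Frobenius

variable {l m n : Type*} [Fintype l] [Fintype m] [Fintype n]

theorem frobenius_norm_sq (A : Matrix m n ℝ) : ‖A‖ ^ 2 = ∑ i, ∑ j, A i j ^ 2 := by
  rw [frobenius_norm_def, ← Real.sqrt_eq_rpow, Real.sq_sqrt (by positivity)]
  simp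

theorem frobenius_norm_sq_eq_trace (A : Matrix m n ℝ) : ‖A‖ ^ 2 = (A * Aᵀ).trace := by
  rw [frobenius_norm_sq]
  simp [Matrix.trace, Matrix.mul_apply, sq]

theorem frobNorm_eq_norm {q r : ℕ} (A : Matrix (Fin q) (Fin r) ℝ) : frobNorm A = ‖A‖ := by
  rw [frobNorm, ← frobenius_norm_sq_eq_trace, Real.sqrt_sq (norm_nonneg _)]

/-- Pythagoras for a symmetric idempotent acting on the right. -/
theorem norm_mul_projection_sq_add [DecidableEq m] (A : Matrix l m ℝ) {H : Matrix m m ℝ}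
    (hs : Hᵀ = H) (hi : H * H = H) : ‖A * H‖ ^ 2 + ‖A * (1 - H)‖ ^ 2 = ‖A‖ ^ 2 := by
  simp only [frobenius_norm_sq_eq_trace, transpose_mul, hs, transpose_sub, transpose_one]
  rw [← Matrix.trace_add]
  congr 1
  have h1 : A * H * (H * Aᵀ) = A * H * Aᵀ := by
    rw [Matrix.mul_assoc, ← Matrix.mul_assoc H, hi, Matrix.mul_assoc]
  have h2 : A * (1 - H) * ((1 - H) * Aᵀ) = A * Aᵀ - A * H * Aᵀ := by
    have : (1 - H) * (1 - H) = 1 - H := by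
      simp [Matrix.mul_sub, Matrix.sub_mul, hi]
    rw [Matrix.mul_assoc, ← Matrix.mul_assoc (1 - H), this, Matrix.sub_mul, Matrix.mul_sub]
    simp [Matrix.mul_assoc]
  rw [h1, h2]; abel

theorem norm_mul_projection_le [DecidableEq m] (A : Matrix l m ℝ) {H : Matrix m m ℝ}
    (hs : Hᵀ = H) (hi : H * H = H) : ‖A * H‖ ≤ ‖A‖ := by
  have := norm_mul_projection_sq_add A hs hi
  refine le_of_sq_le_sq ?_ (norm_nonneg _)
  nlinarith [sq_nonneg ‖A * (1 - H)‖]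

theorem norm_diagonal_diag_le [DecidableEq m] (A : Matrix m m ℝ) :
    ‖Matrix.diagonal A.diag‖ ≤ ‖A‖ := by
  refine le_of_sq_le_sq ?_ (norm_nonneg _)
  rw [frobenius_norm_sq, frobenius_norm_sq]
  refine Finset.sum_le_sum fun i _ => Finset.sum_le_sum fun j _ => ?_
  by_cases h : i = j
  · subst h; simp
  · simp [h, sq_nonneg]

theorem abs_dotProduct_le (v w : m → ℝ) : |v ⬝ᵥ w| ≤ ‖WithLp.toLp 2 v‖ * ‖WithLp.toLp 2 w‖ := by
  have := abs_real_inner_le_norm (WithLp.toLp 2 w) (WithLp.toLp 2 v)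
  simpa [EuclideanSpace.inner_toLp_toLp, mul_comm] using this

theorem norm_mulVec_le (A : Matrix m n ℝ) (v : n → ℝ) :
    ‖WithLp.toLp 2 (A *ᵥ v)‖ ≤ ‖A‖ * ‖WithLp.toLp 2 v‖ := by
  rw [← frobenius_norm_replicateCol (ι := Unit), ← frobenius_norm_replicateCol (ι := Unit),
    Matrix.replicateCol_mulVec]
  exact frobenius_norm_mul _ _

theorem abs_dotProduct_mulVec_le (A : Matrix m m ℝ) (v : m → ℝ) :
    |v ⬝ᵥ A *ᵥ v| ≤ ‖A‖ * (v ⬝ᵥ v) := by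
  have h0 : v ⬝ᵥ v = ‖WithLp.toLp 2 v‖ ^ 2 := by
    rw [← real_inner_self_eq_norm_sq, EuclideanSpace.inner_toLp_toLp]; simp
  rw [h0]
  calc _ ≤ _ := abs_dotProduct_le _ _
    _ ≤ ‖WithLp.toLp 2 v‖ * (‖A‖ * ‖WithLp.toLp 2 v‖) := by gcongr; exact norm_mulVec_le _ _
    _ = _ := by ring

end Frobenius

/-! ### Perturbation of eigenvalues and coercivity of quadratic forms. -/

section Eigen

variable {q : ℕ} {A A' : Matrix (Fin q) (Fin q) ℝ}

theorem inner_toEuclideanLin_self (A : Matrix (Fin q) (Fin q) ℝ) (x : EuclideanSpace ℝ (Fin q)) :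
    inner ℝ (toEuclideanLin A x) x = x.ofLp ⬝ᵥ A *ᵥ x.ofLp := by
  simp [PiLp.inner_apply, dotProduct, toLpLin_apply]

theorem lam_le_add (hA : A.IsHermitian) (hA' : A'.IsHermitian) (k : Fin q) :
    lam hA k ≤ lam hA' k + ‖A - A'‖ := by
  refine eigenvalues_le_add_of_inner_le (isSymmetric_toEuclideanLin_iff.mpr hA)
    (isSymmetric_toEuclideanLin_iff.mpr hA') finrank_euclideanSpace (fun x => ?_) _
  rw [inner_toEuclideanLin_self, inner_toEuclideanLin_self]
  have h := (abs_le.1 (abs_dotProduct_mulVec_le (A - A') x.ofLp)).2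
  have h0 : x.ofLp ⬝ᵥ x.ofLp = ‖x‖ ^ 2 := by
    rw [EuclideanSpace.real_norm_sq_eq]; simp [dotProduct, sq]
  rw [Matrix.sub_mulVec, dotProduct_sub, h0] at h
  linarith

theorem maxEigDist_le (hA : A.IsHermitian) (hA' : A'.IsHermitian) :
    maxEigDist hA hA' ≤ frobNorm (A - A') := by
  rw [frobNorm_eq_norm]
  refine Real.iSup_le (fun k => ?_) (norm_nonneg _)
  have h1 := lam_le_add hA hA' k
  have h2 := lam_le_add hA' hA k
  rw [norm_sub_rev] at h2
  exact abs_le.2 ⟨by linarith, by linarith⟩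

theorem maxEigDist_nonneg (hA : A.IsHermitian) (hA' : A'.IsHermitian) :
    0 ≤ maxEigDist hA hA' :=
  Real.iSup_nonneg fun _ => abs_nonneg _

theorem le_dotProduct_mulVec_of_le_lam (hA : A.IsHermitian) {σ : ℝ} (h : ∀ k, σ ≤ lam hA k)
    (v : Fin q → ℝ) : σ * (v ⬝ᵥ v) ≤ v ⬝ᵥ A *ᵥ v := by
  have hT := isSymmetric_toEuclideanLin_iff.mpr hA
  have h1 := inner_apply_self_eq_sum hT finrank_euclideanSpace (WithLp.toLp 2 v)
  have h2 := norm_sq_eq_sum_eigenvectorBasis hT finrank_euclideanSpace (WithLp.toLp 2 v)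
  have h0 : v ⬝ᵥ v = ‖WithLp.toLp 2 v‖ ^ 2 := by
    rw [← real_inner_self_eq_norm_sq, EuclideanSpace.inner_toLp_toLp]; simp
  rw [inner_toEuclideanLin_self] at h1
  rw [h0, h2, Finset.mul_sum]
  refine le_of_le_of_eq (Finset.sum_le_sum fun i _ => ?_) h1.symm
  refine mul_le_mul_of_nonneg_right ?_ (sq_nonneg _)
  -- The spectral sum runs over `Fin (Fintype.card (Fin q))`, whereas `lam` is indexed by `Fin q`.
  have := h (Fin.cast (Fintype.card_fin q) i)
  simpa [lam, IsHermitian.eigenvalues₀] using this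

end Eigen

/-! ### Algebra of the estimators: centering, projections, inverse Gram matrix. -/

section Deterministic

variable {n p K q : ℕ}

/-- The column vector of ones. -/
def onesCol (n : ℕ) : Matrix (Fin n) (Fin 1) ℝ := Matrix.of fun _ _ => 1

/-- The sample mean of the columns of `Z`, as a one-column matrix. -/
def meanCol (Z : Matrix (Fin q) (Fin n) ℝ) : Matrix (Fin q) (Fin 1) ℝ :=
  (n : ℝ)⁻¹ • (Z * onesCol n)

/-- The centering projection `1 - n⁻¹ 1 1ᵀ`. -/
def centering (n : ℕ) : Matrix (Fin n) (Fin n) ℝ :=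
  1 - (n : ℝ)⁻¹ • (onesCol n * (onesCol n)ᵀ)

/-- The projection `Xᵀ (X Xᵀ)⁻¹ X` (zero if `X Xᵀ` is singular). -/
def hatMatrix (X : Matrix (Fin K) (Fin n) ℝ) : Matrix (Fin n) (Fin n) ℝ :=
  Xᵀ * (X * Xᵀ)⁻¹ * X

theorem onesCol_mul_transpose :
    onesCol n * (onesCol n)ᵀ = (Matrix.of fun _ _ => 1 : Matrix (Fin n) (Fin n) ℝ) := by
  ext i j
  simp [onesCol, Matrix.mul_apply]

theorem centering_transpose : (centering n)ᵀ = centering n := by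
  simp [centering, transpose_sub, transpose_mul]

theorem centering_mul_self (hn : n ≠ 0) : centering n * centering n = centering n := by
  have h : (n : ℝ) ≠ 0 := by exact_mod_cast hn
  have h2 : (onesCol n)ᵀ * onesCol n = (n : ℝ) • (1 : Matrix (Fin 1) (Fin 1) ℝ) := by
    ext i j
    simp [onesCol, Matrix.mul_apply, Subsingleton.elim i j]
  have h1 : onesCol n * (onesCol n)ᵀ * (onesCol n * (onesCol n)ᵀ)
      = (n : ℝ) • (onesCol n * (onesCol n)ᵀ) := by
    rw [Matrix.mul_assoc, ← Matrix.mul_assoc (onesCol n)ᵀ, h2]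
    simp
  simp only [centering, Matrix.mul_sub, Matrix.sub_mul, Matrix.one_mul, Matrix.mul_one,
    Matrix.smul_mul, Matrix.mul_smul, h1, smul_smul]
  rw [inv_mul_cancel₀ h]
  simp

theorem sampleCov_eq_centering (Z : Matrix (Fin q) (Fin n) ℝ) :
    sampleCov Z = ((n : ℝ) - 1)⁻¹ • (Z * centering n * Zᵀ) := by
  rw [sampleCov, ← onesCol_mul_transpose, centering, Matrix.mul_sub, Matrix.sub_mul, smul_sub,
    Matrix.mul_one, Matrix.mul_smul, Matrix.smul_mul, smul_smul, mul_inv, mul_comm (n : ℝ)⁻¹]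

theorem sampleCov_eq_meanCol (hn : n ≠ 0) (Z : Matrix (Fin q) (Fin n) ℝ) :
    sampleCov Z = ((n : ℝ) / (n - 1)) •
      ((n : ℝ)⁻¹ • (Z * Zᵀ) - meanCol Z * (meanCol Z)ᵀ) := by
  have h : (n : ℝ) ≠ 0 := by exact_mod_cast hn
  rw [sampleCov, ← onesCol_mul_transpose, meanCol, smul_sub, smul_smul]
  congr 1
  · congr 1; field_simp
  · simp only [transpose_smul, transpose_mul, Matrix.smul_mul, Matrix.mul_smul, smul_smul,
      Matrix.mul_assoc]
    congr 1; field_simp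

theorem hatMatrix_transpose (X : Matrix (Fin K) (Fin n) ℝ) : (hatMatrix X)ᵀ = hatMatrix X := by
  simp [hatMatrix, transpose_mul, Matrix.transpose_nonsing_inv, Matrix.mul_assoc]

/-- No rank condition is needed: if XXᵀ is singular its inverse is read as 0, and the matrix
vanishes. -/
theorem hatMatrix_mul_self (X : Matrix (Fin K) (Fin n) ℝ) :
    hatMatrix X * hatMatrix X = hatMatrix X := by
  by_cases h : IsUnit (X * Xᵀ).det
  · have : hatMatrix X * hatMatrix X
        = Xᵀ * ((X * Xᵀ)⁻¹ * (X * Xᵀ)) * (X * Xᵀ)⁻¹ * X := by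
      simp [hatMatrix, Matrix.mul_assoc]
    rw [this, Matrix.nonsing_inv_mul _ h, Matrix.mul_one, hatMatrix]
  · simp [hatMatrix, Matrix.nonsing_inv_apply_not_isUnit _ h]

theorem loadingHat_mul (X : Matrix (Fin K) (Fin n) ℝ) (Y : Matrix (Fin p) (Fin n) ℝ) :
    loadingHat X Y * X = Y * hatMatrix X := by
  simp [loadingHat, hatMatrix, Matrix.mul_assoc]

/-- The loading estimator enters only through B̂X = YQ, so the inverse is hidden in two
complementary projections. -/
theorem factorCov_eq (X : Matrix (Fin K) (Fin n) ℝ) (Y : Matrix (Fin p) (Fin n) ℝ) :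
    factorCov X Y = ((n : ℝ) - 1)⁻¹ •
        (Y * hatMatrix X * centering n * (Y * hatMatrix X)ᵀ)
      + Matrix.diagonal ((n : ℝ)⁻¹ •
        (Y * (1 - hatMatrix X) * (Y * (1 - hatMatrix X))ᵀ)).diag := by
  rw [factorCov, errCovHat, residual, sampleCov_eq_centering, loadingHat_mul]
  congr 1
  · rw [← loadingHat_mul]
    simp [transpose_mul, Matrix.mul_assoc]
  · rw [Matrix.mul_sub, Matrix.mul_one]

theorem inv_sub_one_le (hn : 2 ≤ n) : ((n : ℝ) - 1)⁻¹ ≤ 2 * (n : ℝ)⁻¹ := by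
  have h : (2 : ℝ) ≤ n := by exact_mod_cast hn
  rw [← div_eq_mul_inv, inv_eq_one_div, div_le_div_iff₀ (by linarith) (by linarith)]
  linarith

/-- Since n/(n-1) = 1 + 1/(n-1) ≤ 2, the deviation is at most twice that of the uncentered moments,
plus a term of order 1/n from the normalisation. -/
theorem norm_sampleCov_sub_le (hn : 2 ≤ n) (Z : Matrix (Fin q) (Fin n) ℝ)
    (F : Matrix (Fin q) (Fin q) ℝ) (μ : Matrix (Fin q) (Fin 1) ℝ) {a b : ℝ}
    (ha : ‖(n : ℝ)⁻¹ • (Z * Zᵀ) - F‖ ≤ a) (hb : ‖meanCol Z - μ‖ ≤ b) :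
    ‖sampleCov Z - (F - μ * μᵀ)‖
      ≤ 2 * (a + b * (2 * ‖μ‖ + b)) + 2 * (n : ℝ)⁻¹ * ‖F - μ * μᵀ‖ := by
  have h : (2 : ℝ) ≤ n := by exact_mod_cast hn
  have hi := inv_sub_one_le hn
  have hpos : 0 < (n : ℝ) - 1 := by linarith
  set m := meanCol Z
  have hb0 : 0 ≤ b := (norm_nonneg _).trans hb
  have ha0 : 0 ≤ a := (norm_nonneg _).trans ha
  have hm : ‖m‖ ≤ ‖μ‖ + b := by
    calc ‖m‖ = ‖μ + (m - μ)‖ := by congr 1; abel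
      _ ≤ ‖μ‖ + ‖m - μ‖ := norm_add_le _ _
      _ ≤ _ := by gcongr
  have hmm : ‖m * mᵀ - μ * μᵀ‖ ≤ b * (2 * ‖μ‖ + b) := by
    have e : m * mᵀ - μ * μᵀ = (m - μ) * mᵀ + μ * (m - μ)ᵀ := by
      simp [Matrix.sub_mul, Matrix.mul_sub, transpose_sub]
    rw [e]
    calc _ ≤ ‖(m - μ) * mᵀ‖ + ‖μ * (m - μ)ᵀ‖ := norm_add_le _ _
      _ ≤ ‖m - μ‖ * ‖mᵀ‖ + ‖μ‖ * ‖(m - μ)ᵀ‖ := by gcongr <;> exact frobenius_norm_mul _ _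
      _ ≤ b * (‖μ‖ + b) + ‖μ‖ * b := by
        rw [frobenius_norm_transpose, frobenius_norm_transpose]; gcongr
      _ = _ := by ring
  have e : sampleCov Z - (F - μ * μᵀ) = ((n : ℝ) / (n - 1)) •
      (((n : ℝ)⁻¹ • (Z * Zᵀ) - F) - (m * mᵀ - μ * μᵀ)) + ((n : ℝ) - 1)⁻¹ • (F - μ * μᵀ) := by
    have h3 : ((n : ℝ) - 1)⁻¹ = (n : ℝ) / (n - 1) - 1 := by field_simp; ring
    rw [sampleCov_eq_meanCol (by omega), h3, sub_smul, one_smul]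
    simp only [smul_sub]
    abel
  rw [e]
  have h2 : (n : ℝ) / (n - 1) ≤ 2 := by rw [div_le_iff₀ hpos]; linarith
  calc _ ≤ _ := norm_add_le _ _
    _ = (n : ℝ) / (n - 1) * ‖((n : ℝ)⁻¹ • (Z * Zᵀ) - F) - (m * mᵀ - μ * μᵀ)‖
        + ((n : ℝ) - 1)⁻¹ * ‖F - μ * μᵀ‖ := by
      rw [norm_smul, norm_smul, Real.norm_of_nonneg (by positivity),
        Real.norm_of_nonneg (by positivity)]
    _ ≤ 2 * (a + b * (2 * ‖μ‖ + b)) + 2 * (n : ℝ)⁻¹ * ‖F - μ * μᵀ‖ := by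
      gcongr
      exact (norm_sub_le _ _).trans (add_le_add ha hmm)

theorem isUnit_det_of_coercive {S : Matrix (Fin K) (Fin K) ℝ} {c : ℝ} (hc : 0 < c)
    (h : ∀ v : Fin K → ℝ, c * (v ⬝ᵥ v) ≤ v ⬝ᵥ S *ᵥ v) : IsUnit S.det := by
  rw [isUnit_iff_ne_zero]
  intro h0
  obtain ⟨v, hv, hv0⟩ := Matrix.exists_mulVec_eq_zero_iff.2 h0
  have := h v
  rw [hv0, dotProduct_zero] at this
  have hpos : 0 < v ⬝ᵥ v := by
    refine lt_of_le_of_ne (Finset.sum_nonneg fun i _ => mul_self_nonneg _) fun h => hv ?_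
    exact dotProduct_self_eq_zero.1 h.symm
  nlinarith

/-- With w = S⁻¹m, expand 0 ≤ |m - cw|² and insert c|w|² ≤ m·w. Symmetry of S plays no role. -/
theorem dotProduct_inv_mulVec_le {S : Matrix (Fin K) (Fin K) ℝ} {c : ℝ} (hc : 0 < c)
    (h : ∀ v : Fin K → ℝ, c * (v ⬝ᵥ v) ≤ v ⬝ᵥ S *ᵥ v) (m : Fin K → ℝ) :
    m ⬝ᵥ S⁻¹ *ᵥ m ≤ c⁻¹ * (m ⬝ᵥ m) := by
  have hu := isUnit_det_of_coercive hc h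
  set w := S⁻¹ *ᵥ m
  have hw : S *ᵥ w = m := by
    rw [mulVec_mulVec, Matrix.mul_nonsing_inv _ hu, one_mulVec]
  have h1 := h w
  rw [hw] at h1
  have h2 : 0 ≤ (m - c • w) ⬝ᵥ (m - c • w) := Finset.sum_nonneg fun i _ => mul_self_nonneg _
  have h3 : (m - c • w) ⬝ᵥ (m - c • w) = m ⬝ᵥ m - 2 * c * (m ⬝ᵥ w) + c ^ 2 * (w ⬝ᵥ w) := by
    simp only [sub_dotProduct, dotProduct_sub, smul_dotProduct, dotProduct_smul, smul_eq_mul]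
    rw [dotProduct_comm w m]; ring
  rw [dotProduct_comm w m] at h1
  rw [inv_mul_eq_div, le_div_iff₀ hc]
  nlinarith

/-- Since Q is a projection, ‖EQ‖² = tr(EXᵀ(XXᵀ)⁻¹XEᵀ), which is bounded row by row. This makes the
part of the errors absorbed by the regression small: pK against np for E itself. -/
theorem norm_mul_hatMatrix_sq_le {X : Matrix (Fin K) (Fin n) ℝ} {c : ℝ} (hc : 0 < c)
    (h : ∀ v : Fin K → ℝ, c * (v ⬝ᵥ v) ≤ v ⬝ᵥ (X * Xᵀ) *ᵥ v) (E : Matrix (Fin p) (Fin n) ℝ) :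
    ‖E * hatMatrix X‖ ^ 2 ≤ c⁻¹ * ‖E * Xᵀ‖ ^ 2 := by
  have e : E * hatMatrix X * (E * hatMatrix X)ᵀ = (E * Xᵀ) * (X * Xᵀ)⁻¹ * (E * Xᵀ)ᵀ := by
    rw [transpose_mul, hatMatrix_transpose, Matrix.mul_assoc, ← Matrix.mul_assoc (hatMatrix X),
      hatMatrix_mul_self]
    simp [hatMatrix, Matrix.mul_assoc]
  rw [frobenius_norm_sq_eq_trace, e, frobenius_norm_sq_eq_trace]
  simp only [Matrix.trace, Finset.mul_sum]
  refine Finset.sum_le_sum fun i _ => ?_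
  have := dotProduct_inv_mulVec_le hc h ((E * Xᵀ) i)
  rw [dotProduct_mulVec] at this
  exact this

end Deterministic

/-! ### Deterministic rates on a typical sample. -/

section Rates

variable {n p K : ℕ}

/-- A realisation of the sample with all empirical moments within their stochastic order of the
population moments; `κ = √K`, `π = √p`, `r = 1/√n`, and `s` is the common constant. -/
structure TypicalSample (X : Matrix (Fin K) (Fin n) ℝ) (E : Matrix (Fin p) (Fin n) ℝ)
    (B : Matrix (Fin p) (Fin K) ℝ) (F : Matrix (Fin K) (Fin K) ℝ) (μ : Matrix (Fin K) (Fin 1) ℝ)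
    (S0 : Matrix (Fin p) (Fin p) ℝ) (s κ π r : ℝ) : Prop where
  two_le : 2 ≤ n
  one_le_s : 1 ≤ s
  one_le_κ : 1 ≤ κ
  one_le_π : 1 ≤ π
  r_pos : 0 < r
  r_sq : r ^ 2 = (n : ℝ)⁻¹
  norm_B : ‖B‖ ≤ s * π
  norm_μ : ‖μ‖ ≤ s * κ
  norm_covF : ‖F - μ * μᵀ‖ ≤ s * κ ^ 2
  norm_cov : ‖B * (F - μ * μᵀ) * Bᵀ + S0‖ ≤ s * π ^ 2
  gram_X : ‖(n : ℝ)⁻¹ • (X * Xᵀ) - F‖ ≤ s * κ ^ 2 * r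
  mean_X : ‖meanCol X - μ‖ ≤ s * κ * r
  cross : ‖(n : ℝ)⁻¹ • (E * Xᵀ)‖ ≤ s * π * κ * r
  gram_E : ‖(n : ℝ)⁻¹ • (E * Eᵀ) - S0‖ ≤ s * π ^ 2 * r
  mean_E : ‖meanCol E‖ ≤ s * π * r
  norm_Y : r * ‖B * X + E‖ ≤ s * π
  norm_BX : r * ‖B * X‖ ≤ s * π

namespace TypicalSample

variable {X : Matrix (Fin K) (Fin n) ℝ} {E : Matrix (Fin p) (Fin n) ℝ}
    {B : Matrix (Fin p) (Fin K) ℝ} {F : Matrix (Fin K) (Fin K) ℝ} {μ : Matrix (Fin K) (Fin 1) ℝ}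
    {S0 : Matrix (Fin p) (Fin p) ℝ} {s κ π r : ℝ}

theorem r_le_one (h : TypicalSample X E B F μ S0 s κ π r) : r ≤ 1 := by
  have h2 : (2 : ℝ) ≤ n := by exact_mod_cast h.two_le
  have : r ^ 2 ≤ 1 := by rw [h.r_sq]; exact inv_le_one_of_one_le₀ (by linarith)
  nlinarith [h.r_pos]

theorem norm_sampleCov_X_sub_le (h : TypicalSample X E B F μ S0 s κ π r) :
    ‖sampleCov X - (F - μ * μᵀ)‖ ≤ 10 * s ^ 2 * κ ^ 2 * r := by
  have hr := h.r_le_one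
  have hr0 := h.r_pos
  have hs := h.one_le_s
  have hκ := h.one_le_κ
  refine (norm_sampleCov_sub_le h.two_le X F μ h.gram_X h.mean_X).trans ?_
  rw [← h.r_sq]
  calc _ ≤ 2 * (s * κ ^ 2 * r + s * κ * r * (2 * (s * κ) + s * κ * r))
        + 2 * r ^ 2 * (s * κ ^ 2) := by
        gcongr
        · exact h.norm_μ
        · exact h.norm_covF
    _ = (2 * s + 4 * s ^ 2 + 2 * s ^ 2 * r + 2 * s * r) * (κ ^ 2 * r) := by ring
    _ ≤ (2 * s ^ 2 + 4 * s ^ 2 + 2 * s ^ 2 * 1 + 2 * s ^ 2 * 1) * (κ ^ 2 * r) := by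
        have : s ≤ s ^ 2 := by nlinarith
        gcongr
    _ = _ := by ring

/-- In the expansion of YYᵀ the factor part B(n⁻¹XXᵀ - F)Bᵀ dominates, with order pK/√n; the cross
terms and the error part are no larger. -/
theorem norm_gram_Y_sub_le (h : TypicalSample X E B F μ S0 s κ π r) :
    ‖(n : ℝ)⁻¹ • ((B * X + E) * (B * X + E)ᵀ) - (B * F * Bᵀ + S0)‖
      ≤ 4 * s ^ 3 * π ^ 2 * κ ^ 2 * r := by
  have hr0 := h.r_pos
  have hs := h.one_le_s
  have hκ := h.one_le_κ
  have hπ := h.one_le_π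
  have e : (n : ℝ)⁻¹ • ((B * X + E) * (B * X + E)ᵀ) - (B * F * Bᵀ + S0)
      = B * ((n : ℝ)⁻¹ • (X * Xᵀ) - F) * Bᵀ + B * ((n : ℝ)⁻¹ • (E * Xᵀ))ᵀ
        + ((n : ℝ)⁻¹ • (E * Xᵀ)) * Bᵀ + ((n : ℝ)⁻¹ • (E * Eᵀ) - S0) := by
    simp only [transpose_add, transpose_mul, transpose_smul, transpose_transpose, Matrix.add_mul,
      Matrix.mul_add, Matrix.mul_sub, Matrix.sub_mul, Matrix.smul_mul, Matrix.mul_smul, smul_add,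
      Matrix.mul_assoc]
    abel
  rw [e]
  have hb : ‖Bᵀ‖ ≤ s * π := by rw [frobenius_norm_transpose]; exact h.norm_B
  have hc : ‖((n : ℝ)⁻¹ • (E * Xᵀ))ᵀ‖ ≤ s * π * κ * r := by
    rw [frobenius_norm_transpose]; exact h.cross
  have t1 : ‖B * ((n : ℝ)⁻¹ • (X * Xᵀ) - F) * Bᵀ‖ ≤ s * π * (s * κ ^ 2 * r) * (s * π) :=
    (frobenius_norm_mul _ _).trans (mul_le_mul ((frobenius_norm_mul _ _).trans
      (mul_le_mul h.norm_B h.gram_X (norm_nonneg _) (by positivity))) hb (norm_nonneg _)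
      (by positivity))
  have t2 : ‖B * ((n : ℝ)⁻¹ • (E * Xᵀ))ᵀ‖ ≤ s * π * (s * π * κ * r) :=
    (frobenius_norm_mul _ _).trans (mul_le_mul h.norm_B hc (norm_nonneg _) (by positivity))
  have t3 : ‖((n : ℝ)⁻¹ • (E * Xᵀ)) * Bᵀ‖ ≤ s * π * κ * r * (s * π) :=
    (frobenius_norm_mul _ _).trans (mul_le_mul h.cross hb (norm_nonneg _) (by positivity))
  refine (norm_add₄_le).trans ((add_le_add (add_le_add (add_le_add t1 t2) t3) h.gram_E).trans ?_)
  have h1 : s ≤ s ^ 3 := le_self_pow₀ hs (by norm_num)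
  have h2 : s ^ 2 ≤ s ^ 3 := pow_le_pow_right₀ hs (by norm_num)
  have h3 : κ ≤ κ ^ 2 := le_self_pow₀ hκ (by norm_num)
  have h4 : 1 ≤ κ ^ 2 := one_le_pow₀ hκ
  calc _ = (s ^ 3 * κ ^ 2 + s ^ 2 * κ + s ^ 2 * κ + s * 1) * (π ^ 2 * r) := by ring
    _ ≤ (s ^ 3 * κ ^ 2 + s ^ 3 * κ ^ 2 + s ^ 3 * κ ^ 2 + s ^ 3 * κ ^ 2) * (π ^ 2 * r) := by gcongr
    _ = _ := by ring

theorem norm_sampleCov_Y_sub_le (h : TypicalSample X E B F μ S0 s κ π r) :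
    ‖sampleCov (B * X + E) - (B * (F - μ * μᵀ) * Bᵀ + S0)‖
      ≤ 26 * s ^ 4 * (π ^ 2 * κ ^ 2 * r) := by
  have hr := h.r_le_one
  have hr0 := h.r_pos
  have hs := h.one_le_s
  have hκ := h.one_le_κ
  have hπ := h.one_le_π
  have hm : ‖meanCol (B * X + E) - B * μ‖ ≤ 2 * s ^ 2 * π * κ * r := by
    have e : meanCol (B * X + E) - B * μ = B * (meanCol X - μ) + meanCol E := by
      simp only [meanCol, Matrix.add_mul, Matrix.mul_sub, Matrix.mul_smul, smul_add,
        Matrix.mul_assoc]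
      abel
    rw [e]
    have t1 : ‖B * (meanCol X - μ)‖ ≤ s * π * (s * κ * r) :=
      (frobenius_norm_mul _ _).trans (mul_le_mul h.norm_B h.mean_X (norm_nonneg _) (by positivity))
    refine (norm_add_le _ _).trans ((add_le_add t1 h.mean_E).trans ?_)
    have h1 : s * 1 ≤ s ^ 2 * κ := by
      have : s ≤ s ^ 2 := by nlinarith
      gcongr
    calc _ = (s ^ 2 * κ + s * 1) * (π * r) := by ring
      _ ≤ (s ^ 2 * κ + s ^ 2 * κ) * (π * r) := by gcongr
      _ = _ := by ring
  have hBμ : ‖B * μ‖ ≤ s ^ 2 * π * κ := by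
    calc _ ≤ s * π * (s * κ) := (frobenius_norm_mul _ _).trans
          (mul_le_mul h.norm_B h.norm_μ (norm_nonneg _) (by positivity))
      _ = _ := by ring
  have e : B * (F - μ * μᵀ) * Bᵀ + S0 = (B * F * Bᵀ + S0) - (B * μ) * (B * μ)ᵀ := by
    simp only [transpose_mul, Matrix.mul_sub, Matrix.sub_mul, Matrix.mul_assoc]
    abel
  have hcov := h.norm_cov
  rw [e] at hcov ⊢
  refine (norm_sampleCov_sub_le h.two_le _ _ _ h.norm_gram_Y_sub_le hm).trans ?_
  rw [← h.r_sq]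
  -- After raising every power of s to 4 and of κ to 2, the coefficients add up to 8 + 8 + 8 + 2 =
  -- 26.
  calc _ ≤ 2 * (4 * s ^ 3 * π ^ 2 * κ ^ 2 * r
        + 2 * s ^ 2 * π * κ * r * (2 * (s ^ 2 * π * κ) + 2 * s ^ 2 * π * κ * r))
        + 2 * r ^ 2 * (s * π ^ 2) := by gcongr
    _ = (8 * s ^ 3 * κ ^ 2 + 8 * s ^ 4 * κ ^ 2 + 8 * s ^ 4 * κ ^ 2 * r + 2 * (s * 1) * r)
        * (π ^ 2 * r) := by ring
    _ ≤ (8 * s ^ 4 * κ ^ 2 + 8 * s ^ 4 * κ ^ 2 + 8 * s ^ 4 * κ ^ 2 * 1 + 2 * (s ^ 4 * κ ^ 2) * 1)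
        * (π ^ 2 * r) := by
        have h1 : s ≤ s ^ 4 := le_self_pow₀ hs (by norm_num)
        have h2 : s ^ 3 ≤ s ^ 4 := pow_le_pow_right₀ hs (by norm_num)
        have h4 : 1 ≤ κ ^ 2 := one_le_pow₀ hκ
        gcongr
    _ = _ := by ring

/-- Valid even for singular XXᵀ. Projections contract and taking the diagonal does not increase the
norm, so Pythagoras bounds both parts by 2r²‖Y‖². -/
theorem norm_factorCov_le (h : TypicalSample X E B F μ S0 s κ π r) :
    ‖factorCov X (B * X + E)‖ ≤ 2 * s ^ 2 * π ^ 2 := by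
  have hn : 2 ≤ n := h.two_le
  have hn' : (2 : ℝ) ≤ n := by exact_mod_cast hn
  have hn1 : (0 : ℝ) < n - 1 := by linarith
  have hr0 := h.r_pos
  set Y := B * X + E
  have hY : r ^ 2 * ‖Y‖ ^ 2 ≤ s ^ 2 * π ^ 2 := by
    rw [← mul_pow, ← mul_pow]
    exact pow_le_pow_left₀ (by positivity) h.norm_Y 2
  have hpyth := norm_mul_projection_sq_add Y (hatMatrix_transpose X) (hatMatrix_mul_self X)
  have t1 : ‖((n : ℝ) - 1)⁻¹ • (Y * hatMatrix X * centering n * (Y * hatMatrix X)ᵀ)‖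
      ≤ 2 * r ^ 2 * ‖Y * hatMatrix X‖ ^ 2 := by
    rw [norm_smul, Real.norm_of_nonneg (by positivity), h.r_sq, sq ‖_‖]
    refine mul_le_mul (inv_sub_one_le hn) ((frobenius_norm_mul _ _).trans ?_) (norm_nonneg _)
      (by positivity)
    rw [frobenius_norm_transpose]
    gcongr
    exact norm_mul_projection_le _ centering_transpose (centering_mul_self (by omega))
  have t2 : ‖Matrix.diagonal ((n : ℝ)⁻¹ •
        (Y * (1 - hatMatrix X) * (Y * (1 - hatMatrix X))ᵀ)).diag‖
      ≤ r ^ 2 * ‖Y * (1 - hatMatrix X)‖ ^ 2 := by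
    refine (norm_diagonal_diag_le _).trans ?_
    rw [norm_smul, Real.norm_of_nonneg (by positivity), h.r_sq, sq ‖_‖]
    gcongr
    refine (frobenius_norm_mul _ _).trans_eq ?_
    rw [frobenius_norm_transpose]
  rw [factorCov_eq]
  refine (norm_add_le _ _).trans ((add_le_add t1 t2).trans ?_)
  nlinarith [mul_nonneg (sq_nonneg r) (sq_nonneg ‖Y * (1 - hatMatrix X)‖),
    congrArg (fun t => r ^ 2 * t) hpyth]

/-- The Gram matrix n⁻¹XXᵀ is cov(f) + μμᵀ plus a deviation. The second term is nonnegative and the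
deviation costs at most half of σ. -/
theorem coercive_gram (h : TypicalSample X E B F μ S0 s κ π r) {σ : ℝ}
    (hσ : ∀ v : Fin K → ℝ, σ * (v ⬝ᵥ v) ≤ v ⬝ᵥ (F - μ * μᵀ) *ᵥ v)
    (hsmall : s * κ ^ 2 * r ≤ σ / 2) (v : Fin K → ℝ) :
    n * (σ / 2) * (v ⬝ᵥ v) ≤ v ⬝ᵥ (X * Xᵀ) *ᵥ v := by
  have hn' : (0 : ℝ) < n := by exact_mod_cast (by have := h.two_le; omega : 0 < n)
  have h1 := hσ v
  have h2 := (abs_le.1 (abs_dotProduct_mulVec_le ((n : ℝ)⁻¹ • (X * Xᵀ) - F) v)).1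
  have hvv : 0 ≤ v ⬝ᵥ v := Finset.sum_nonneg fun i _ => mul_self_nonneg _
  have h3 : ‖(n : ℝ)⁻¹ • (X * Xᵀ) - F‖ * (v ⬝ᵥ v) ≤ σ / 2 * (v ⬝ᵥ v) :=
    mul_le_mul_of_nonneg_right (h.gram_X.trans hsmall) hvv
  have h4 : 0 ≤ v ⬝ᵥ (μ * μᵀ) *ᵥ v := by
    rw [← mulVec_mulVec, dotProduct_mulVec, ← mulVec_transpose]
    exact Finset.sum_nonneg fun i _ => mul_self_nonneg _
  rw [sub_mulVec, dotProduct_sub] at h1 h2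
  rw [smul_mulVec, dotProduct_smul, smul_eq_mul] at h2
  have h5 : σ / 2 * (v ⬝ᵥ v) ≤ (n : ℝ)⁻¹ * (v ⬝ᵥ (X * Xᵀ) *ᵥ v) := by linarith
  rw [inv_mul_eq_div, le_div_iff₀ hn'] at h5
  linarith

/-- Invertibility gives XQ = X: the fit is BX + EQ and the residual E(1 - Q) no longer contains the
factors. The cross terms cost r²‖BX‖‖EQ‖, of order pr√K. -/
theorem norm_factorCov_sub_le_of_small (h : TypicalSample X E B F μ S0 s κ π r)
    (hdiag : S0.IsDiag) {σ : ℝ} (hσ0 : 0 < σ) (hσs : 2 / σ ≤ s ^ 2)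
    (hσ : ∀ v : Fin K → ℝ, σ * (v ⬝ᵥ v) ≤ v ⬝ᵥ (F - μ * μᵀ) *ᵥ v)
    (hsmall : s * κ ^ 2 * r ≤ σ / 2) :
    ‖factorCov X (B * X + E) - (B * (F - μ * μᵀ) * Bᵀ + S0)‖
      ≤ 18 * s ^ 4 * (π ^ 2 * κ ^ 2 * r) := by
  have hn : 2 ≤ n := h.two_le
  have hn' : (2 : ℝ) ≤ n := by exact_mod_cast hn
  have hn1 : (0 : ℝ) < n - 1 := by linarith
  have hr := h.r_le_one
  have hr0 := h.r_pos
  have hs := h.one_le_s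
  have hκ := h.one_le_κ
  have hπ := h.one_le_π
  have hco := h.coercive_gram hσ hsmall
  have hc : 0 < (n : ℝ) * (σ / 2) := by positivity
  have hu := isUnit_det_of_coercive hc hco
  set Q := hatMatrix X
  have hXQ : X * Q = X := by
    simp only [Q, hatMatrix]
    rw [← Matrix.mul_assoc, ← Matrix.mul_assoc, Matrix.mul_nonsing_inv _ hu, Matrix.one_mul]
  have hEQ : ‖E * Q‖ ≤ s ^ 2 * π * κ := by
    refine le_of_sq_le_sq ?_ (by positivity)
    have h1 := norm_mul_hatMatrix_sq_le hc hco E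
    have h2 : ‖E * Xᵀ‖ ≤ n * (s * π * κ * r) := by
      have := h.cross
      rw [norm_smul, Real.norm_of_nonneg (by positivity), inv_mul_eq_div,
        div_le_iff₀ (by linarith)] at this
      linarith
    refine h1.trans ?_
    -- The sample size cancels because nr² = 1.
    calc _ ≤ ((n : ℝ) * (σ / 2))⁻¹ * (n * (s * π * κ * r)) ^ 2 := by gcongr
      _ = (2 / σ) * (s * π * κ) ^ 2 * (n * r ^ 2) := by field_simp
      _ = (2 / σ) * (s * π * κ) ^ 2 := by rw [h.r_sq, mul_inv_cancel₀ (by linarith), mul_one]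
      _ ≤ s ^ 2 * (s * π * κ) ^ 2 := by gcongr
      _ = _ := by ring
  have hQt : Qᵀ = Q := hatMatrix_transpose X
  have hQQ : Q * Q = Q := hatMatrix_mul_self X
  have hH : ∀ A : Matrix (Fin p) (Fin n) ℝ, ‖A * centering n‖ ≤ ‖A‖ := fun A =>
    norm_mul_projection_le _ centering_transpose (centering_mul_self (by omega))
  have hXQ' : (B * X + E) * Q = B * X + E * Q := by
    rw [Matrix.add_mul, Matrix.mul_assoc, hXQ]
  have hres : (B * X + E) * (1 - Q) = E * (1 - Q) := by
    rw [Matrix.add_mul, Matrix.mul_assoc, Matrix.mul_sub X, hXQ]; simp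
  have hEE : E * (1 - Q) * (E * (1 - Q))ᵀ = E * Eᵀ - E * Q * (E * Q)ᵀ := by
    have h1 : (1 - Q) * (1 - Q) = 1 - Q := by simp [Matrix.mul_sub, Matrix.sub_mul, hQQ]
    rw [transpose_mul, transpose_mul, transpose_sub, hQt, transpose_one, Matrix.mul_assoc,
      ← Matrix.mul_assoc (1 - Q), h1, Matrix.mul_assoc E Q, ← Matrix.mul_assoc Q, hQQ]
    simp [Matrix.sub_mul, Matrix.mul_sub]
  -- Diagonality of S0 is used here: it lets S0 be moved inside the diagonal part.
  have e : factorCov X (B * X + E) - (B * (F - μ * μᵀ) * Bᵀ + S0)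
      = B * (sampleCov X - (F - μ * μᵀ)) * Bᵀ
        + ((n : ℝ) - 1)⁻¹ • (B * X * centering n * (E * Q)ᵀ + E * Q * centering n * (B * X)ᵀ
            + E * Q * centering n * (E * Q)ᵀ)
        + Matrix.diagonal ((n : ℝ)⁻¹ • (E * Eᵀ) - S0).diag
        - Matrix.diagonal ((n : ℝ)⁻¹ • (E * Q * (E * Q)ᵀ)).diag := by
    have hds : ∀ u v : Fin p → ℝ, diagonal (u - v) = diagonal u - diagonal v := fun u v =>
      (diagonal_sub u v).symm
    have hS : Matrix.diagonal S0.diag = S0 := hdiag.diagonal_diag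
    rw [factorCov_eq, sampleCov_eq_centering]
    rw [show hatMatrix X = Q from rfl, hXQ', hres, hEE, smul_sub, diag_sub, diag_sub, hds, hds, hS]
    simp only [transpose_add, Matrix.add_mul, Matrix.mul_add, Matrix.mul_sub, Matrix.sub_mul,
      smul_add, Matrix.smul_mul, Matrix.mul_smul, transpose_mul, Matrix.mul_assoc]
    abel
  rw [e]
  have hb : ‖Bᵀ‖ ≤ s * π := by rw [frobenius_norm_transpose]; exact h.norm_B
  have t1 : ‖B * (sampleCov X - (F - μ * μᵀ)) * Bᵀ‖
      ≤ s * π * (10 * s ^ 2 * κ ^ 2 * r) * (s * π) :=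
    (frobenius_norm_mul _ _).trans (mul_le_mul ((frobenius_norm_mul _ _).trans
      (mul_le_mul h.norm_B h.norm_sampleCov_X_sub_le (norm_nonneg _) (by positivity))) hb
      (norm_nonneg _) (by positivity))
  have u1 : ‖B * X * centering n * (E * Q)ᵀ‖ ≤ ‖B * X‖ * (s ^ 2 * π * κ) := by
    refine (frobenius_norm_mul _ _).trans ?_
    rw [frobenius_norm_transpose]
    gcongr
    exact hH _
  have u2 : ‖E * Q * centering n * (B * X)ᵀ‖ ≤ (s ^ 2 * π * κ) * ‖B * X‖ := by
    refine (frobenius_norm_mul _ _).trans ?_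
    rw [frobenius_norm_transpose]
    gcongr
    exact (hH _).trans hEQ
  have u3 : ‖E * Q * centering n * (E * Q)ᵀ‖ ≤ (s ^ 2 * π * κ) * (s ^ 2 * π * κ) := by
    refine (frobenius_norm_mul _ _).trans ?_
    rw [frobenius_norm_transpose]
    gcongr
    exact (hH _).trans hEQ
  have t2 : ‖((n : ℝ) - 1)⁻¹ • (B * X * centering n * (E * Q)ᵀ
      + E * Q * centering n * (B * X)ᵀ + E * Q * centering n * (E * Q)ᵀ)‖
      ≤ 4 * r * (s * π) * (s ^ 2 * π * κ) + 2 * r ^ 2 * (s ^ 2 * π * κ) ^ 2 := by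
    rw [norm_smul, Real.norm_of_nonneg (by positivity)]
    calc _ ≤ 2 * r ^ 2 * (‖B * X‖ * (s ^ 2 * π * κ) + (s ^ 2 * π * κ) * ‖B * X‖
          + (s ^ 2 * π * κ) * (s ^ 2 * π * κ)) := by
          rw [h.r_sq]
          exact mul_le_mul (inv_sub_one_le hn)
            ((norm_add₃_le).trans (add_le_add (add_le_add u1 u2) u3)) (norm_nonneg _)
            (by positivity)
      _ = 4 * r * (r * ‖B * X‖) * (s ^ 2 * π * κ) + 2 * r ^ 2 * (s ^ 2 * π * κ) ^ 2 := by ring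
      _ ≤ _ := by
          have := h.norm_BX
          gcongr
  have t3 : ‖Matrix.diagonal ((n : ℝ)⁻¹ • (E * Eᵀ) - S0).diag‖ ≤ s * π ^ 2 * r :=
    (norm_diagonal_diag_le _).trans h.gram_E
  have t4 : ‖Matrix.diagonal ((n : ℝ)⁻¹ • (E * Q * (E * Q)ᵀ)).diag‖
      ≤ r ^ 2 * (s ^ 2 * π * κ) ^ 2 := by
    refine (norm_diagonal_diag_le _).trans ?_
    rw [norm_smul, Real.norm_of_nonneg (by positivity), h.r_sq, sq (s ^ 2 * π * κ)]
    gcongr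
    refine (frobenius_norm_mul _ _).trans ?_
    rw [frobenius_norm_transpose]
    gcongr
  refine (norm_sub_le _ _).trans ((add_le_add norm_add₃_le le_rfl).trans
    ((add_le_add (add_le_add (add_le_add t1 t2) t3) t4).trans ?_))
  calc _ = (10 * s ^ 4 * κ ^ 2 + (4 * s ^ 3 * κ + 2 * s ^ 4 * κ ^ 2 * r) + s * 1
        + s ^ 4 * κ ^ 2 * r) * (π ^ 2 * r) := by ring
    _ ≤ (10 * s ^ 4 * κ ^ 2 + (4 * s ^ 4 * κ ^ 2 + 2 * s ^ 4 * κ ^ 2 * 1) + s ^ 4 * κ ^ 2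
        + s ^ 4 * κ ^ 2 * 1) * (π ^ 2 * r) := by
        have h1 : s ≤ s ^ 4 := le_self_pow₀ hs (by norm_num)
        have h2 : s ^ 3 ≤ s ^ 4 := pow_le_pow_right₀ hs (by norm_num)
        have h3 : κ ≤ κ ^ 2 := le_self_pow₀ hκ (by norm_num)
        have h4 : 1 ≤ κ ^ 2 := one_le_pow₀ hκ
        gcongr
    _ = _ := by ring

/-- If sκ²r exceeds σ/2, then 1 ≤ s³κ²r. The trivial bound 3s²π² on the error is then already of the
required order. -/
theorem norm_factorCov_sub_le (h : TypicalSample X E B F μ S0 s κ π r)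
    (hdiag : S0.IsDiag) {σ : ℝ} (hσ0 : 0 < σ) (hσs : 2 / σ ≤ s ^ 2)
    (hσ : ∀ v : Fin K → ℝ, σ * (v ⬝ᵥ v) ≤ v ⬝ᵥ (F - μ * μᵀ) *ᵥ v) :
    ‖factorCov X (B * X + E) - (B * (F - μ * μᵀ) * Bᵀ + S0)‖
      ≤ 18 * s ^ 5 * (π ^ 2 * κ ^ 2 * r) := by
  have hr0 := h.r_pos
  have hs := h.one_le_s
  have hκ := h.one_le_κ
  have hπ := h.one_le_π
  rcases le_or_gt (s * κ ^ 2 * r) (σ / 2) with hsmall | hbig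
  · refine (h.norm_factorCov_sub_le_of_small hdiag hσ0 hσs hσ hsmall).trans ?_
    have : s ^ 4 ≤ s ^ 5 := pow_le_pow_right₀ hs (by norm_num)
    gcongr
  · have h1 : 1 ≤ s ^ 3 * (κ ^ 2 * r) := by
      calc (1 : ℝ) = 2 / σ * (σ / 2) := by field_simp
        _ ≤ s ^ 2 * (s * κ ^ 2 * r) := by gcongr
        _ = _ := by ring
    have h2 : s ≤ s ^ 2 := le_self_pow₀ hs (by norm_num)
    calc _ ≤ 2 * s ^ 2 * π ^ 2 + s * π ^ 2 :=
          (norm_sub_le _ _).trans (add_le_add h.norm_factorCov_le h.norm_cov)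
      _ ≤ 2 * s ^ 2 * π ^ 2 + s ^ 2 * π ^ 2 := by gcongr
      _ = 3 * s ^ 2 * π ^ 2 * 1 := by ring
      _ ≤ 18 * s ^ 2 * π ^ 2 * (s ^ 3 * (κ ^ 2 * r)) := by gcongr; norm_num
      _ = _ := by ring

end TypicalSample

end Rates

/-! ### Moment inequalities. -/

section Moments

variable {Ω : Type*} [MeasurableSpace Ω] {P : Measure Ω} {U V : Ω → ℝ}

theorem memLp_two_mul (hU : MemLp U 4 P) (hV : MemLp V 4 P) :
    MemLp (fun ω => U ω * V ω) 2 P := by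
  have : ENNReal.HolderTriple 4 4 2 := ⟨by
    rw [show (4 : ENNReal) = 2 * 2 by norm_num, ENNReal.mul_inv (by simp) (by simp), ← mul_add,
      ENNReal.inv_two_add_inv_two, mul_one]⟩
  exact hV.mul' hU

theorem integrable_pow_four (hU : MemLp U 4 P) : Integrable (fun ω => U ω ^ 4) P := by
  have := (memLp_two_mul hU hU).integrable_sq
  refine this.congr (ae_of_all _ fun ω => ?_)
  ring

/-- From 2U²V² ≤ U⁴ + V⁴; this is why fourth moments are assumed. -/
theorem integral_mul_sq_le {C : ℝ} (hU : MemLp U 4 P) (hV : MemLp V 4 P)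
    (hUC : ∫ ω, U ω ^ 4 ∂P ≤ C) (hVC : ∫ ω, V ω ^ 4 ∂P ≤ C) :
    ∫ ω, (U ω * V ω) ^ 2 ∂P ≤ C := by
  have h1 := integrable_pow_four hU
  have h2 := integrable_pow_four hV
  calc ∫ ω, (U ω * V ω) ^ 2 ∂P ≤ ∫ ω, (2⁻¹ * U ω ^ 4 + 2⁻¹ * V ω ^ 4) ∂P := by
        refine integral_mono (memLp_two_mul hU hV).integrable_sq
          ((h1.const_mul _).add (h2.const_mul _)) fun ω => ?_
        show (U ω * V ω) ^ 2 ≤ 2⁻¹ * U ω ^ 4 + 2⁻¹ * V ω ^ 4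
        nlinarith [sq_nonneg (U ω ^ 2 - V ω ^ 2)]
    _ = 2⁻¹ * ∫ ω, U ω ^ 4 ∂P + 2⁻¹ * ∫ ω, V ω ^ 4 ∂P := by
        rw [integral_add (h1.const_mul _) (h2.const_mul _), integral_const_mul, integral_const_mul]
    _ ≤ C := by linarith

variable [IsProbabilityMeasure P]

theorem memLp_two_of_four (hU : MemLp U 4 P) : MemLp U 2 P :=
  hU.mono_exponent (by norm_num)

theorem integral_sq_le_of_pow_four {C : ℝ} (hC : 1 ≤ C) (hU : MemLp U 4 P)
    (hUC : ∫ ω, U ω ^ 4 ∂P ≤ C) : ∫ ω, U ω ^ 2 ∂P ≤ C := by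
  -- The constant 1 serves as second factor, whence the requirement 1 ≤ C.
  have := integral_mul_sq_le (V := fun _ => 1) hU (memLp_const 1) hUC (by simpa using hC)
  simpa using this

theorem sq_integral_le_integral_sq (hU : MemLp U 2 P) :
    (∫ ω, U ω ∂P) ^ 2 ≤ ∫ ω, U ω ^ 2 ∂P := by
  have h1 := variance_eq_sub hU
  have h2 := variance_nonneg U P
  simp only [Pi.pow_apply] at h1
  linarith

theorem variance_le_integral_sq (hU : MemLp U 2 P) : Var[U; P] ≤ ∫ ω, U ω ^ 2 ∂P := by
  have h1 := variance_eq_sub hU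
  simp only [Pi.pow_apply] at h1
  nlinarith [sq_nonneg (∫ ω, U ω ∂P)]

/-- Var(U + tV) is a nonnegative quadratic in t, so its discriminant is nonpositive. -/
theorem covariance_sq_le (hU : MemLp U 2 P) (hV : MemLp V 2 P) :
    cov[U, V; P] ^ 2 ≤ Var[U; P] * Var[V; P] := by
  have h : ∀ t : ℝ, 0 ≤ Var[V; P] * (t * t) + 2 * cov[U, V; P] * t + Var[U; P] := fun t => by
    have h1 := variance_add hU (hV.const_smul t)
    rw [covariance_smul_right, variance_smul] at h1
    have := variance_nonneg (U + t • V) P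
    linarith
  have := discrim_le_zero h
  rw [discrim] at this
  nlinarith

/-- Cauchy–Schwarz in each entry bounds the Frobenius norm by the trace. For y this gives O(p) from
E‖y‖² = O(p). -/
theorem norm_covMat_le {q : ℕ} {Z : Ω → Fin q → ℝ} (hZ : ∀ i, MemLp (fun ω => Z ω i) 2 P) :
    ‖covMat P Z‖ ≤ ∑ i, Var[fun ω => Z ω i; P] := by
  refine le_of_sq_le_sq ?_ (Finset.sum_nonneg fun i _ => variance_nonneg _ _)
  rw [frobenius_norm_sq, sq, Finset.sum_mul_sum]
  exact Finset.sum_le_sum fun i _ => Finset.sum_le_sum fun j _ => covariance_sq_le (hZ i) (hZ j)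

end Moments

/-! ### Second moments of averages of i.i.d. observations. -/

section Sampling

variable {Ω : Type*} [MeasurableSpace Ω] {P : Measure Ω}
  {α : Type*} [MeasurableSpace α] {n : ℕ} {Z : Ω → α} {Zs : Fin n → Ω → α}

theorem integral_average (hn : n ≠ 0) (hid : ∀ a, IdentDistrib (Zs a) Z P P) {φ : α → ℝ}
    (hφ : Measurable φ) (hi : Integrable (fun ω => φ (Z ω)) P) :
    ∫ ω, (n : ℝ)⁻¹ * ∑ a, φ (Zs a ω) ∂P = ∫ ω, φ (Z ω) ∂P := by
  have hn' : (n : ℝ) ≠ 0 := by exact_mod_cast hn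
  have h1 : ∀ a, ∫ ω, φ (Zs a ω) ∂P = ∫ ω, φ (Z ω) ∂P := fun a => ((hid a).comp hφ).integral_eq
  rw [integral_const_mul, integral_finsetSum _ fun a _ => by
    exact ((hid a).comp hφ).integrable_iff.2 hi]
  simp [h1, hn']

/-- Mean of the squared Frobenius norm of a data matrix. -/
theorem integral_norm_sq_data (hid : ∀ a, IdentDistrib (Zs a) Z P P) {q : ℕ}
    {φ : Fin q → α → ℝ} (hφ : ∀ i, Measurable (φ i)) (hi : ∀ i, MemLp (fun ω => φ i (Z ω)) 2 P)
    {R : Ω → Matrix (Fin q) (Fin n) ℝ} (hR : ∀ ω i a, R ω i a = φ i (Zs a ω)) :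
    Integrable (fun ω => ‖R ω‖ ^ 2) P ∧
      ∫ ω, ‖R ω‖ ^ 2 ∂P = n * ∑ i, ∫ ω, φ i (Z ω) ^ 2 ∂P := by
  have hid' : ∀ i a, IdentDistrib (fun ω => φ i (Zs a ω) ^ 2) (fun ω => φ i (Z ω) ^ 2) P P :=
    fun i a => (hid a).comp (u := fun z => φ i z ^ 2) ((hφ i).pow_const 2)
  have hint : ∀ i a, Integrable (fun ω => R ω i a ^ 2) P := fun i a => by
    simp only [hR]
    exact (hid' i a).integrable_iff.2 (hi i).integrable_sq
  simp only [frobenius_norm_sq]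
  refine ⟨integrable_finsetSum _ fun i _ => integrable_finsetSum _ fun j _ => hint i j, ?_⟩
  rw [integral_finsetSum _ fun i _ => integrable_finsetSum _ fun j _ => hint i j, Finset.mul_sum]
  refine Finset.sum_congr rfl fun i _ => ?_
  rw [integral_finsetSum _ fun j _ => hint i j]
  have : ∀ a, ∫ ω, R ω i a ^ 2 ∂P = ∫ ω, φ i (Z ω) ^ 2 ∂P := fun a => by
    simp only [hR]
    exact (hid' i a).integral_eq
  simp [this]

variable [IsProbabilityMeasure P]

theorem memLp_average_sub (hid : ∀ a, IdentDistrib (Zs a) Z P P) {φ : α → ℝ} (hφ : Measurable φ)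
    (hi : MemLp (fun ω => φ (Z ω)) 2 P) (m : ℝ) :
    MemLp (fun ω => (n : ℝ)⁻¹ * ∑ a, φ (Zs a ω) - m) 2 P :=
  ((memLp_finsetSum _ fun a _ => ((hid a).comp hφ).memLp_iff.2 hi).const_mul _).sub
    (memLp_const m)

theorem integral_average_sub_sq_le (hn : n ≠ 0) (hind : iIndepFun Zs P)
    (hid : ∀ a, IdentDistrib (Zs a) Z P P) {φ : α → ℝ} (hφ : Measurable φ)
    (hi : MemLp (fun ω => φ (Z ω)) 2 P) :
    ∫ ω, ((n : ℝ)⁻¹ * ∑ a, φ (Zs a ω) - ∫ ω', φ (Z ω') ∂P) ^ 2 ∂P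
      ≤ (n : ℝ)⁻¹ * ∫ ω, φ (Z ω) ^ 2 ∂P := by
  have hn' : (n : ℝ) ≠ 0 := by exact_mod_cast hn
  have hL : ∀ a, MemLp (fun ω => φ (Zs a ω)) 2 P := fun a => ((hid a).comp hφ).memLp_iff.2 hi
  have hS : MemLp (fun ω => (n : ℝ)⁻¹ * ∑ a, φ (Zs a ω)) 2 P :=
    (memLp_finsetSum _ fun a _ => hL a).const_mul _
  have h1 := variance_eq_integral hS.aemeasurable
  rw [integral_average hn hid hφ (hi.integrable (by norm_num))] at h1
  rw [← h1, variance_const_mul]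
  have h2 : Var[∑ a, fun ω => φ (Zs a ω); P] = ∑ a, Var[fun ω => φ (Zs a ω); P] :=
    IndepFun.variance_sum (fun a _ => hL a) fun a _ b _ hab =>
      (hind.indepFun hab).comp hφ hφ
  have h3 : (∑ a, fun ω => φ (Zs a ω)) = fun ω => ∑ a, φ (Zs a ω) := by
    ext ω; simp
  rw [h3] at h2
  have h4 : ∀ a, Var[fun ω => φ (Zs a ω); P] = Var[fun ω => φ (Z ω); P] := fun a =>
    ((hid a).comp hφ).variance_eq
  rw [h2]
  simp only [h4, Finset.sum_const, Finset.card_univ, Fintype.card_fin, nsmul_eq_mul]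
  calc _ = (n : ℝ)⁻¹ * Var[fun ω => φ (Z ω); P] := by field_simp
    _ ≤ _ := by gcongr; exact variance_le_integral_sq hi

/-- Second moment of the Frobenius distance of a matrix of sample averages from its mean. -/
theorem integral_norm_average_sub_sq_le (hn : n ≠ 0) (hind : iIndepFun Zs P)
    (hid : ∀ a, IdentDistrib (Zs a) Z P P) {q t : ℕ} {φ : Fin q → Fin t → α → ℝ}
    (hφ : ∀ i j, Measurable (φ i j)) (hi : ∀ i j, MemLp (fun ω => φ i j (Z ω)) 2 P) {C : ℝ}
    (hC : ∀ i j, ∫ ω, φ i j (Z ω) ^ 2 ∂P ≤ C) {R : Ω → Matrix (Fin q) (Fin t) ℝ}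
    (hR : ∀ ω i j, R ω i j = (n : ℝ)⁻¹ * ∑ a, φ i j (Zs a ω) - ∫ ω', φ i j (Z ω') ∂P) :
    Integrable (fun ω => ‖R ω‖ ^ 2) P ∧ ∫ ω, ‖R ω‖ ^ 2 ∂P ≤ q * t * C * (n : ℝ)⁻¹ := by
  have hint : ∀ i j, Integrable (fun ω => R ω i j ^ 2) P := fun i j => by
    simp only [hR]
    exact (memLp_average_sub hid (hφ i j) (hi i j) _).integrable_sq
  simp only [frobenius_norm_sq]
  refine ⟨integrable_finsetSum _ fun i _ => integrable_finsetSum _ fun j _ => hint i j, ?_⟩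
  rw [integral_finsetSum _ fun i _ => integrable_finsetSum _ fun j _ => hint i j]
  calc _ ≤ ∑ _i : Fin q, ∑ _j : Fin t, (n : ℝ)⁻¹ * C := by
        refine Finset.sum_le_sum fun i _ => ?_
        rw [integral_finsetSum _ fun j _ => hint i j]
        refine Finset.sum_le_sum fun j _ => ?_
        simp only [hR]
        refine (integral_average_sub_sq_le hn hind hid (hφ i j) (hi i j)).trans ?_
        have := hC i j
        gcongr
    _ = _ := by simp; ring

end Sampling

/-! ### Population moments implied by the factor model. -/

section Population

variable {Ω : Type*} [MeasurableSpace Ω] {P : Measure Ω} {n p K : ℕ}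
  {B : Matrix (Fin p) (Fin K) ℝ} {S0 : Matrix (Fin p) (Fin p) ℝ}
  {f : Ω → Fin K → ℝ} {y : Ω → Fin p → ℝ}
  {fs : Fin n → Ω → Fin K → ℝ} {ys : Fin n → Ω → Fin p → ℝ}

/-- The second-moment matrix `E f fᵀ`. -/
def secondMoment {q : ℕ} (P : Measure Ω) (Z : Ω → Fin q → ℝ) : Matrix (Fin q) (Fin q) ℝ :=
  Matrix.of fun i j => ∫ ω, Z ω i * Z ω j ∂P

/-- The mean of a random vector, as a one-column matrix. -/
def popMean {q : ℕ} (P : Measure Ω) (Z : Ω → Fin q → ℝ) : Matrix (Fin q) (Fin 1) ℝ :=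
  Matrix.of fun i _ => ∫ ω, Z ω i ∂P

theorem covMat_eq_secondMoment_sub [IsProbabilityMeasure P] {q : ℕ} {Z : Ω → Fin q → ℝ}
    (hZ : ∀ i, MemLp (fun ω => Z ω i) 2 P) :
    covMat P Z = secondMoment P Z - popMean P Z * (popMean P Z)ᵀ := by
  ext i j
  simp [covMat, secondMoment, popMean, Matrix.mul_apply, covariance_eq_sub (hZ i) (hZ j)]

namespace ConditionA

theorem comap_le (hA : ConditionA P B S0 f y fs ys) :
    MeasurableSpace.comap f inferInstance ≤ (inferInstance : MeasurableSpace Ω) :=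
  hA.measurable_f.comap_le

theorem integral_err [IsProbabilityMeasure P] (hA : ConditionA P B S0 f y fs ys) (i : Fin p) :
    ∫ ω, err B f y ω i ∂P = 0 := by
  rw [← integral_condExp hA.comap_le, integral_congr_ae (hA.condMean i)]
  simp

theorem integral_err_mul_err [IsProbabilityMeasure P] (hA : ConditionA P B S0 f y fs ys)
    (i j : Fin p) : ∫ ω, err B f y ω i * err B f y ω j ∂P = S0 i j := by
  have h1 := hA.condCov i j
  have h2 : ∫ ω, FactorCov.condCov P (MeasurableSpace.comap f inferInstance)
      (fun ω => err B f y ω i) (fun ω => err B f y ω j) ω ∂P = S0 i j := by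
    rw [integral_congr_ae h1]; simp
  rw [← h2, FactorCov.condCov, integral_condExp hA.comap_le]
  refine integral_congr_ae ?_
  filter_upwards [hA.condMean i, hA.condMean j] with ω h3 h4
  simp [h3, h4]

/-- A component of f is measurable for the σ-algebra of f, so it leaves the conditional expectation,
which vanishes. -/
theorem integral_err_mul_factor [IsProbabilityMeasure P] (hA : ConditionA P B S0 f y fs ys)
    (hf : ∀ i, MemLp (fun ω => f ω i) 4 P)
    (he : ∀ i, MemLp (fun ω => err B f y ω i) 4 P) (i : Fin p) (j : Fin K) :
    ∫ ω, err B f y ω i * f ω j ∂P = 0 := by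
  have hsm : StronglyMeasurable[MeasurableSpace.comap f inferInstance] fun ω => f ω j :=
    ((measurable_pi_apply j).comp (comap_measurable f)).stronglyMeasurable
  have h1 := condExp_mul_of_stronglyMeasurable_right hsm
    ((memLp_two_mul (he i) (hf j)).integrable (by norm_num))
    ((he i).integrable (by norm_num))
  have h2 := integral_condExp hA.comap_le (μ := P)
    (f := (fun ω => err B f y ω i) * fun ω => f ω j)
  rw [integral_congr_ae h1] at h2
  have h3 : ∫ ω, err B f y ω i * f ω j ∂P
      = ∫ ω, ((fun ω => err B f y ω i) * fun ω => f ω j) ω ∂P := rfl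
  rw [h3, ← h2]
  have h4 : P[fun ω => err B f y ω i | MeasurableSpace.comap f inferInstance] * (fun ω => f ω j)
      =ᵐ[P] 0 := by
    filter_upwards [hA.condMean i] with ω h
    simp [h]
  rw [integral_congr_ae h4]
  simp

theorem covMat_y_eq [IsProbabilityMeasure P] (hA : ConditionA P B S0 f y fs ys)
    (hf : ∀ i, MemLp (fun ω => f ω i) 4 P)
    (he : ∀ i, MemLp (fun ω => err B f y ω i) 4 P) :
    covMat P y = B * covMat P f * Bᵀ + S0 := by
  have hf2 := fun i => memLp_two_of_four (hf i)
  have he2 := fun i => memLp_two_of_four (he i)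
  have hBf : ∀ i, MemLp (fun ω => ∑ k, B i k * f ω k) 2 P := fun i =>
    memLp_finsetSum _ fun k _ => (hf2 k).const_mul _
  have hfe : ∀ k i, cov[fun ω => f ω k, fun ω => err B f y ω i; P] = 0 := fun k i => by
    rw [covariance_comm, covariance_eq_sub (he2 i) (hf2 k), hA.integral_err i]
    have := hA.integral_err_mul_factor hf he i k
    simpa using this
  have hBfe : ∀ i j, cov[fun ω => ∑ k, B i k * f ω k, fun ω => err B f y ω j; P] = 0 :=
    fun i j => by
      rw [covariance_fun_sum_left (fun k => (hf2 k).const_mul _) (he2 j)]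
      simp [covariance_const_mul_left, hfe]
  have hee : ∀ i j, cov[fun ω => err B f y ω i, fun ω => err B f y ω j; P] = S0 i j :=
    fun i j => by
      rw [covariance_eq_sub (he2 i) (he2 j), hA.integral_err i, ← hA.integral_err_mul_err i j]
      simp
  ext i j
  have hy : ∀ i, (fun ω => y ω i)
      = (fun ω => ∑ k, B i k * f ω k) + fun ω => err B f y ω i := fun i => by
    ext ω; simp [err, mulVec, dotProduct]
  simp only [covMat, Matrix.of_apply, Matrix.add_apply]
  rw [hy i, hy j, covariance_add_left (hBf i) (he2 i) ((hBf j).add (he2 j)),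
    covariance_add_right (hBf i) (hBf j) (he2 j), covariance_add_right (he2 i) (hBf j) (he2 j),
    hBfe, covariance_comm (fun ω => err B f y ω i), hBfe, hee,
    covariance_fun_sum_fun_sum (fun k => (hf2 k).const_mul _) (fun k => (hf2 k).const_mul _)]
  simp only [covariance_const_mul_left, covariance_const_mul_right, Matrix.mul_apply,
    Matrix.of_apply, transpose_apply, Finset.sum_mul, zero_add, add_zero]
  rw [Finset.sum_comm]
  congr 1
  refine Finset.sum_congr rfl fun k _ => Finset.sum_congr rfl fun l _ => by ring

end ConditionA

end Population

/-! ### The unobserved errors as functions of the observations. -/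

section Errors

variable {Ω : Type*} {n p K : ℕ} {B : Matrix (Fin p) (Fin K) ℝ} {f : Ω → Fin K → ℝ}
  {y : Ω → Fin p → ℝ} {fs : Fin n → Ω → Fin K → ℝ} {ys : Fin n → Ω → Fin p → ℝ}

/-- The matrix of unobserved errors. -/
def errMatrix (B : Matrix (Fin p) (Fin K) ℝ) (fs : Fin n → Ω → Fin K → ℝ)
    (ys : Fin n → Ω → Fin p → ℝ) (ω : Ω) : Matrix (Fin p) (Fin n) ℝ :=
  dataMatrix ys ω - B * dataMatrix fs ω

theorem mul_dataMatrix_add_errMatrix (ω : Ω) :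
    B * dataMatrix fs ω + errMatrix B fs ys ω = dataMatrix ys ω := by
  simp [errMatrix]

/-- Each error is one fixed function of the pair (f_a, y_a), so the i.i.d. hypothesis on the pairs
carries over to the errors. -/
theorem errMatrix_apply (ω : Ω) (i : Fin p) (a : Fin n) :
    errMatrix B fs ys ω i a = err B Prod.fst Prod.snd (fs a ω, ys a ω) i := rfl

theorem mulVec_add_err (ω : Ω) (i : Fin p) : (B *ᵥ f ω) i + err B f y ω i = y ω i := by
  simp [err]

theorem measurable_err_prod (i : Fin p) :
    Measurable fun z : (Fin K → ℝ) × (Fin p → ℝ) => err B Prod.fst Prod.snd z i := by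
  simp only [err, Pi.sub_apply, mulVec, dotProduct]
  fun_prop

theorem measurable_mulVec_fst (i : Fin p) :
    Measurable fun z : (Fin K → ℝ) × (Fin p → ℝ) => (B *ᵥ z.1) i := by
  simp only [mulVec, dotProduct]
  fun_prop

end Errors

/-! ### From moment bounds to typical samples. -/

section Concentration

variable {Ω : Type*} [MeasurableSpace Ω] {P : Measure Ω} {n p K : ℕ}
  {B : Matrix (Fin p) (Fin K) ℝ} {S0 : Matrix (Fin p) (Fin p) ℝ}
  {f : Ω → Fin K → ℝ} {y : Ω → Fin p → ℝ}
  {fs : Fin n → Ω → Fin K → ℝ} {ys : Fin n → Ω → Fin p → ℝ}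

/-- Condition (B) at a fixed sample size, with explicit constants. -/
structure MomentBounds (P : Measure Ω) (B : Matrix (Fin p) (Fin K) ℝ) (f : Ω → Fin K → ℝ)
    (y : Ω → Fin p → ℝ) (C σ : ℝ) : Prop where
  one_le : 1 ≤ C
  pos : 0 < σ
  memLp_f : ∀ i, MemLp (fun ω => f ω i) 4 P
  memLp_err : ∀ i, MemLp (fun ω => err B f y ω i) 4 P
  moment_f : ∀ i, ∫ ω, f ω i ^ 4 ∂P ≤ C
  moment_err : ∀ i, ∫ ω, err B f y ω i ^ 4 ∂P ≤ C
  moment_y : ∫ ω, ∑ i, y ω i ^ 2 ∂P ≤ C * p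
  eig_lower : ∀ k, σ ≤ lam (covMat_isHermitian P f) k

/-- Sum of the squared deviations of the empirical moments, in units of their order. -/
def discrepancy (B : Matrix (Fin p) (Fin K) ℝ) (F : Matrix (Fin K) (Fin K) ℝ)
    (μ : Matrix (Fin K) (Fin 1) ℝ) (S0 : Matrix (Fin p) (Fin p) ℝ)
    (X : Matrix (Fin K) (Fin n) ℝ) (E : Matrix (Fin p) (Fin n) ℝ) (κ π r : ℝ) : ℝ :=
  ‖(n : ℝ)⁻¹ • (X * Xᵀ) - F‖ ^ 2 / (κ ^ 2 * r) ^ 2 + ‖meanCol X - μ‖ ^ 2 / (κ * r) ^ 2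
    + ‖(n : ℝ)⁻¹ • (E * Xᵀ)‖ ^ 2 / (π * κ * r) ^ 2
    + ‖(n : ℝ)⁻¹ • (E * Eᵀ) - S0‖ ^ 2 / (π ^ 2 * r) ^ 2 + ‖meanCol E‖ ^ 2 / (π * r) ^ 2
    + ‖B * X + E‖ ^ 2 / (π / r) ^ 2 + ‖B * X‖ ^ 2 / (π / r) ^ 2

theorem discrepancy_nonneg {F : Matrix (Fin K) (Fin K) ℝ} {μ : Matrix (Fin K) (Fin 1) ℝ}
    {X : Matrix (Fin K) (Fin n) ℝ} {E : Matrix (Fin p) (Fin n) ℝ} {κ π r : ℝ} :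
    0 ≤ discrepancy B F μ S0 X E κ π r := by
  unfold discrepancy
  positivity

theorem le_mul_of_sq_div_sq_le {a s t : ℝ} (hs : 0 ≤ s) (ht : 0 < t)
    (h : a ^ 2 / t ^ 2 ≤ s ^ 2) : a ≤ s * t := by
  rw [← div_pow] at h
  have := le_of_sq_le_sq h hs
  rwa [div_le_iff₀ ht] at this

section PopulationBounds

variable [IsProbabilityMeasure P] {C σ : ℝ}

namespace MomentBounds

theorem memLp_mulVec (h : MomentBounds P B f y C σ) (i : Fin p) :
    MemLp (fun ω => (B *ᵥ f ω) i) 2 P :=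
  memLp_finsetSum Finset.univ fun k _ => (memLp_two_of_four (h.memLp_f k)).const_mul (B i k)

theorem memLp_y (h : MomentBounds P B f y C σ) (i : Fin p) : MemLp (fun ω => y ω i) 2 P := by
  have := (h.memLp_mulVec i).add (memLp_two_of_four (h.memLp_err i))
  exact this.ae_eq (ae_of_all _ fun ω => mulVec_add_err ω i)

theorem sum_integral_y_sq_le (h : MomentBounds P B f y C σ) :
    ∑ i, ∫ ω, y ω i ^ 2 ∂P ≤ C * p := by
  rw [← integral_finsetSum _ fun i _ => (h.memLp_y i).integrable_sq]
  exact h.moment_y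

theorem sum_integral_mulVec_sq_le (h : MomentBounds P B f y C σ) :
    ∑ i, ∫ ω, (B *ᵥ f ω) i ^ 2 ∂P ≤ 4 * C * p := by
  have he2 := fun i => memLp_two_of_four (h.memLp_err i)
  calc ∑ i, ∫ ω, (B *ᵥ f ω) i ^ 2 ∂P
      ≤ ∑ i, (2 * ∫ ω, y ω i ^ 2 ∂P + 2 * C) := by
        refine Finset.sum_le_sum fun i _ => ?_
        have h1 : ∫ ω, (B *ᵥ f ω) i ^ 2 ∂P
            ≤ ∫ ω, (2 * y ω i ^ 2 + 2 * err B f y ω i ^ 2) ∂P := by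
          refine integral_mono (h.memLp_mulVec i).integrable_sq
            (((h.memLp_y i).integrable_sq.const_mul 2).add ((he2 i).integrable_sq.const_mul 2))
            fun ω => ?_
          show (B *ᵥ f ω) i ^ 2 ≤ 2 * y ω i ^ 2 + 2 * err B f y ω i ^ 2
          rw [← mulVec_add_err (B := B) (f := f) (y := y) ω i]
          -- With a = (Bf)_i and e the error, 2(a + e)² + 2e² - a² = (a + 2e)².
          nlinarith [sq_nonneg ((B *ᵥ f ω) i + 2 * err B f y ω i)]
        rw [integral_add ((h.memLp_y i).integrable_sq.const_mul 2)
          ((he2 i).integrable_sq.const_mul 2), integral_const_mul, integral_const_mul] at h1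
        have := integral_sq_le_of_pow_four h.one_le (h.memLp_err i) (h.moment_err i)
        linarith
    _ = 2 * ∑ i, ∫ ω, y ω i ^ 2 ∂P + 2 * C * p := by
        rw [Finset.sum_add_distrib, Finset.mul_sum]; simp; ring
    _ ≤ _ := by linarith [h.sum_integral_y_sq_le]

theorem norm_popMean_sq_le (h : MomentBounds P B f y C σ) : ‖popMean P f‖ ^ 2 ≤ C * K := by
  rw [frobenius_norm_sq]
  calc _ ≤ ∑ _i : Fin K, C := by
        refine Finset.sum_le_sum fun i _ => ?_
        simp only [popMean, of_apply, Fin.sum_univ_one]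
        exact (sq_integral_le_integral_sq (memLp_two_of_four (h.memLp_f i))).trans
          (integral_sq_le_of_pow_four h.one_le (h.memLp_f i) (h.moment_f i))
    _ = _ := by simp [mul_comm]

theorem norm_covMat_f_le (h : MomentBounds P B f y C σ) : ‖covMat P f‖ ≤ C * K := by
  have hf := fun i => memLp_two_of_four (h.memLp_f i)
  refine (norm_covMat_le hf).trans ?_
  calc _ ≤ ∑ _i : Fin K, C := Finset.sum_le_sum fun i _ => (variance_le_integral_sq (hf i)).trans
          (integral_sq_le_of_pow_four h.one_le (h.memLp_f i) (h.moment_f i))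
    _ = _ := by simp [mul_comm]

theorem sum_variance_y_le (h : MomentBounds P B f y C σ) :
    ∑ i, Var[fun ω => y ω i; P] ≤ C * p :=
  (Finset.sum_le_sum fun i _ => variance_le_integral_sq (h.memLp_y i)).trans
    h.sum_integral_y_sq_le

theorem norm_covMat_y_le (h : MomentBounds P B f y C σ) : ‖covMat P y‖ ≤ C * p :=
  (norm_covMat_le h.memLp_y).trans h.sum_variance_y_le

/-- For a row b_i of B, Var(y_i) = b_i'cov(f)b_i + S0_ii ≥ σ|b_i|². Summing over i compares σ‖B‖²
with the total variance of y. -/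
theorem norm_loading_sq_le (h : MomentBounds P B f y C σ) (hA : ConditionA P B S0 f y fs ys) :
    ‖B‖ ^ 2 ≤ C / σ * p := by
  have h1 : σ * ‖B‖ ^ 2 ≤ ∑ i, Var[fun ω => y ω i; P] := by
    rw [frobenius_norm_sq, Finset.mul_sum]
    refine Finset.sum_le_sum fun i _ => ?_
    have h2 := le_dotProduct_mulVec_of_le_lam (covMat_isHermitian P f) h.eig_lower (B i)
    have h3 : B i ⬝ᵥ covMat P f *ᵥ B i = (B * covMat P f * Bᵀ) i i := by
      rw [dotProduct_mulVec]; rfl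
    have h4 : covMat P y i i = (B * covMat P f * Bᵀ) i i + S0 i i := by
      rw [hA.covMat_y_eq h.memLp_f h.memLp_err]; rfl
    have h5 : covMat P y i i = Var[fun ω => y ω i; P] :=
      covariance_self (h.memLp_y i).aemeasurable
    have h6 : 0 ≤ S0 i i := by
      rw [← hA.integral_err_mul_err]
      exact integral_nonneg fun ω => mul_self_nonneg _
    have h7 : B i ⬝ᵥ B i = ∑ j, B i j ^ 2 := by simp [dotProduct, sq]
    rw [h7, h3] at h2
    linarith
  rw [div_mul_eq_mul_div, le_div_iff₀ h.pos]
  linarith [h.sum_variance_y_le]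

end MomentBounds

end PopulationBounds

variable [IsProbabilityMeasure P] {C σ : ℝ}

/-- Each scale t is chosen so that its term has mean at most C, except the BX term, where y = Bf + ε
gives 4C. Hence 6C + 4C. -/
theorem integral_discrepancy_le (hn : n ≠ 0) (hA : ConditionA P B S0 f y fs ys)
    (h : MomentBounds P B f y C σ) {κ π r : ℝ} (hκ : 0 < κ) (hπ : 0 < π) (hr : 0 < r)
    (hκK : κ ^ 2 = K) (hπp : π ^ 2 = p) (hrn : r ^ 2 = (n : ℝ)⁻¹) :
    Integrable (fun ω => discrepancy B (secondMoment P f) (popMean P f) S0 (dataMatrix fs ω)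
        (errMatrix B fs ys ω) κ π r) P ∧
      ∫ ω, discrepancy B (secondMoment P f) (popMean P f) S0 (dataMatrix fs ω)
        (errMatrix B fs ys ω) κ π r ∂P ≤ 10 * C := by
  have hn' : (n : ℝ) ≠ 0 := by exact_mod_cast hn
  have hf2 := fun i => memLp_two_of_four (h.memLp_f i)
  have he2 := fun i => memLp_two_of_four (h.memLp_err i)
  have hsqf := fun i => integral_sq_le_of_pow_four h.one_le (h.memLp_f i) (h.moment_f i)
  have hsqe := fun i => integral_sq_le_of_pow_four h.one_le (h.memLp_err i) (h.moment_err i)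
  have hme := fun i => measurable_err_prod (B := B) i
  have hmB := fun i => measurable_mulVec_fst (B := B) i
  have key : ∀ {g : Ω → ℝ} {D t : ℝ}, 0 < t → Integrable g P ∧ ∫ ω, g ω ∂P ≤ D * t ^ 2 →
      Integrable (fun ω => g ω / t ^ 2) P ∧ ∫ ω, g ω / t ^ 2 ∂P ≤ D := fun ht hg => by
    refine ⟨hg.1.div_const _, ?_⟩
    rw [integral_div, div_le_iff₀ (by positivity)]
    exact hg.2
  obtain ⟨i1, b1⟩ := key (g := fun ω => ‖(n : ℝ)⁻¹ • (dataMatrix fs ω * (dataMatrix fs ω)ᵀ)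
      - secondMoment P f‖ ^ 2) (D := C) (t := κ ^ 2 * r) (by positivity) <| by
    refine (integral_norm_average_sub_sq_le hn hA.indep hA.ident
      (φ := fun i j z => z.1 i * z.1 j) (fun i j => by fun_prop)
      (fun i j => memLp_two_mul (h.memLp_f i) (h.memLp_f j)) (C := C)
      (fun i j => integral_mul_sq_le (h.memLp_f i) (h.memLp_f j) (h.moment_f i) (h.moment_f j))
      fun ω i j => ?_).imp_right fun hb => hb.trans_eq ?_
    · simp [Matrix.mul_apply, dataMatrix, secondMoment]
    · rw [mul_pow, hrn, hκK]; ring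
  obtain ⟨i2, b2⟩ := key (g := fun ω => ‖meanCol (dataMatrix fs ω) - popMean P f‖ ^ 2)
      (D := C) (t := κ * r) (by positivity) <| by
    refine (integral_norm_average_sub_sq_le hn hA.indep hA.ident
      (φ := fun i _ z => z.1 i) (fun i j => by fun_prop)
      (fun i j => hf2 i) (C := C) (fun i j => hsqf i)
      fun ω i j => ?_).imp_right fun hb => hb.trans_eq ?_
    · simp [meanCol, Matrix.mul_apply, dataMatrix, popMean, onesCol]
    · rw [mul_pow, hrn, hκK]; push_cast; ring
  obtain ⟨i3, b3⟩ := key (g := fun ω => ‖(n : ℝ)⁻¹ •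
      (errMatrix B fs ys ω * (dataMatrix fs ω)ᵀ)‖ ^ 2)
      (D := C) (t := π * κ * r) (by positivity) <| by
    refine (integral_norm_average_sub_sq_le hn hA.indep hA.ident
      (φ := fun i j z => err B Prod.fst Prod.snd z i * z.1 j)
      (fun i j => (hme i).mul (by fun_prop))
      (fun i j => memLp_two_mul (h.memLp_err i) (h.memLp_f j)) (C := C)
      (fun i j => integral_mul_sq_le (h.memLp_err i) (h.memLp_f j) (h.moment_err i)
        (h.moment_f j))
      fun ω i j => ?_).imp_right fun hb => hb.trans_eq ?_
    · have := hA.integral_err_mul_factor h.memLp_f h.memLp_err i j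
      -- The function on the observation space, evaluated at (f, y), is definitionally the
      -- population error times a factor.
      change _ = _ - ∫ ω, err B f y ω i * f ω j ∂P
      rw [this]
      simp [Matrix.mul_apply, errMatrix_apply, dataMatrix]
    · rw [mul_pow, mul_pow, hrn, hκK, hπp]; ring
  obtain ⟨i4, b4⟩ := key (g := fun ω => ‖(n : ℝ)⁻¹ •
      (errMatrix B fs ys ω * (errMatrix B fs ys ω)ᵀ) - S0‖ ^ 2)
      (D := C) (t := π ^ 2 * r) (by positivity) <| by
    refine (integral_norm_average_sub_sq_le hn hA.indep hA.ident
      (φ := fun i j z => err B Prod.fst Prod.snd z i * err B Prod.fst Prod.snd z j)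
      (fun i j => (hme i).mul (hme j))
      (fun i j => memLp_two_mul (h.memLp_err i) (h.memLp_err j)) (C := C)
      (fun i j => integral_mul_sq_le (h.memLp_err i) (h.memLp_err j) (h.moment_err i)
        (h.moment_err j))
      fun ω i j => ?_).imp_right fun hb => hb.trans_eq ?_
    · have := hA.integral_err_mul_err i j
      change _ = _ - ∫ ω, err B f y ω i * err B f y ω j ∂P
      rw [this]
      simp [Matrix.mul_apply, errMatrix_apply]
    · rw [mul_pow, hrn, hπp]; ring
  obtain ⟨i5, b5⟩ := key (g := fun ω => ‖meanCol (errMatrix B fs ys ω)‖ ^ 2)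
      (D := C) (t := π * r) (by positivity) <| by
    refine (integral_norm_average_sub_sq_le hn hA.indep hA.ident
      (φ := fun i (_ : Fin 1) z => err B Prod.fst Prod.snd z i) (fun i j => hme i)
      (fun i j => he2 i) (C := C) (fun i j => hsqe i)
      fun ω i j => ?_).imp_right fun hb => hb.trans_eq ?_
    · have := hA.integral_err i
      change _ = _ - ∫ ω, err B f y ω i ∂P
      rw [this]
      simp [meanCol, Matrix.mul_apply, errMatrix_apply, onesCol]
    · rw [mul_pow, hrn, hπp]; push_cast; ring
  have hdiv : (π / r) ^ 2 = p * n := by rw [div_pow, hπp, hrn, div_inv_eq_mul]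
  obtain ⟨i6, b6⟩ := key (g := fun ω => ‖B * dataMatrix fs ω + errMatrix B fs ys ω‖ ^ 2)
      (D := C) (t := π / r) (by positivity) <| by
    refine (integral_norm_sq_data hA.ident
      (φ := fun i z => z.2 i) (fun i => by fun_prop) h.memLp_y
      fun ω i a => ?_).imp_right fun hb => hb.trans_le ?_
    · rw [mul_dataMatrix_add_errMatrix]; rfl
    · rw [hdiv]
      calc _ ≤ (n : ℝ) * (C * p) := by gcongr; exact h.sum_integral_y_sq_le
        _ = _ := by ring
  obtain ⟨i7, b7⟩ := key (g := fun ω => ‖B * dataMatrix fs ω‖ ^ 2)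
      (D := 4 * C) (t := π / r) (by positivity) <| by
    refine (integral_norm_sq_data hA.ident
      (φ := fun i z => (B *ᵥ z.1) i) hmB h.memLp_mulVec
      fun ω i a => ?_).imp_right fun hb => hb.trans_le ?_
    · rfl
    · rw [hdiv]
      calc _ ≤ (n : ℝ) * (4 * C * p) := by gcongr; exact h.sum_integral_mulVec_sq_le
        _ = _ := by ring
  unfold discrepancy
  have j2 := i1.add i2
  have j3 := j2.add i3
  have j4 := j3.add i4
  have j5 := j4.add i5
  have j6 := j5.add i6
  refine ⟨j6.add i7, ?_⟩
  have e6 := integral_add j6 i7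
  have e5 := integral_add j5 i6
  have e4 := integral_add j4 i5
  have e3 := integral_add j3 i4
  have e2 := integral_add j2 i3
  have e1 := integral_add i1 i2
  simp only [Pi.add_apply] at e1 e2 e3 e4 e5 e6
  rw [e6, e5, e4, e3, e2, e1]
  linarith

/-- All summands of the discrepancy are nonnegative, so each is at most s². The remaining fields are
population bounds, absorbed by taking s large. -/
theorem typicalSample_of_discrepancy_le (hn : 2 ≤ n) (hK : 1 ≤ K)
    (hA : ConditionA P B S0 f y fs ys) (h : MomentBounds P B f y C σ) {κ π r s : ℝ} (hκ : 0 < κ)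
    (hπ : 0 < π) (hr : 0 < r) (hκK : κ ^ 2 = K) (hπp : π ^ 2 = p) (hrn : r ^ 2 = (n : ℝ)⁻¹)
    (hCs : C ≤ s) (hσs : C / σ ≤ s) {ω : Ω}
    (hω : discrepancy B (secondMoment P f) (popMean P f) S0 (dataMatrix fs ω)
        (errMatrix B fs ys ω) κ π r ≤ s ^ 2) :
    TypicalSample (dataMatrix fs ω) (errMatrix B fs ys ω) B (secondMoment P f) (popMean P f) S0
      s κ π r := by
  have hs : 1 ≤ s := h.one_le.trans hCs
  have hs0 : 0 ≤ s := by linarith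
  have hss : s ≤ s ^ 2 := le_self_pow₀ hs (by norm_num)
  have hK' : (1 : ℝ) ≤ K := by exact_mod_cast hK
  have hp' : (1 : ℝ) ≤ p := by exact_mod_cast hK.trans hA.le
  have hcov := covMat_eq_secondMoment_sub fun i => memLp_two_of_four (h.memLp_f i)
  have hcovy := hA.covMat_y_eq h.memLp_f h.memLp_err
  unfold discrepancy at hω
  have n1 : 0 ≤ ‖(n : ℝ)⁻¹ • (dataMatrix fs ω * (dataMatrix fs ω)ᵀ) - secondMoment P f‖ ^ 2
    / (κ ^ 2 * r) ^ 2 := by positivity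
  have n2 : 0 ≤ ‖meanCol (dataMatrix fs ω) - popMean P f‖ ^ 2 / (κ * r) ^ 2 := by positivity
  have n3 : 0 ≤ ‖(n : ℝ)⁻¹ • (errMatrix B fs ys ω * (dataMatrix fs ω)ᵀ)‖ ^ 2
    / (π * κ * r) ^ 2 := by positivity
  have n4 : 0 ≤ ‖(n : ℝ)⁻¹ • (errMatrix B fs ys ω * (errMatrix B fs ys ω)ᵀ) - S0‖ ^ 2
    / (π ^ 2 * r) ^ 2 := by positivity
  have n5 : 0 ≤ ‖meanCol (errMatrix B fs ys ω)‖ ^ 2 / (π * r) ^ 2 := by positivity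
  have n6 : 0 ≤ ‖B * dataMatrix fs ω + errMatrix B fs ys ω‖ ^ 2 / (π / r) ^ 2 := by positivity
  have n7 : 0 ≤ ‖B * dataMatrix fs ω‖ ^ 2 / (π / r) ^ 2 := by positivity
  exact
    { two_le := hn
      one_le_s := hs
      one_le_κ := by nlinarith
      one_le_π := by nlinarith
      r_pos := hr
      r_sq := hrn
      norm_B := by
        refine le_of_sq_le_sq ?_ (by positivity)
        rw [mul_pow, hπp]
        exact (h.norm_loading_sq_le hA).trans (by gcongr; linarith)
      norm_μ := by
        refine le_of_sq_le_sq ?_ (by positivity)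
        rw [mul_pow, hκK]
        exact h.norm_popMean_sq_le.trans (by gcongr; linarith)
      norm_covF := by
        rw [← hcov, hκK]
        exact h.norm_covMat_f_le.trans (by gcongr)
      norm_cov := by
        rw [← hcov, ← hcovy, hπp]
        exact h.norm_covMat_y_le.trans (by gcongr)
      gram_X := by
        rw [mul_assoc]
        exact le_mul_of_sq_div_sq_le hs0 (by positivity) (by linarith)
      mean_X := by
        rw [mul_assoc]
        exact le_mul_of_sq_div_sq_le hs0 (by positivity) (by linarith)
      cross := by
        rw [mul_assoc, mul_assoc, ← mul_assoc π]
        exact le_mul_of_sq_div_sq_le hs0 (by positivity) (by linarith)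
      gram_E := by
        rw [mul_assoc]
        exact le_mul_of_sq_div_sq_le hs0 (by positivity) (by linarith)
      mean_E := by
        rw [mul_assoc]
        exact le_mul_of_sq_div_sq_le hs0 (by positivity) (by linarith)
      norm_Y := by
        have := le_mul_of_sq_div_sq_le (a := ‖B * dataMatrix fs ω + errMatrix B fs ys ω‖) hs0
          (div_pos hπ hr) (by linarith)
        rw [← mul_div_assoc, le_div_iff₀ hr] at this
        linarith
      norm_BX := by
        have := le_mul_of_sq_div_sq_le (a := ‖B * dataMatrix fs ω‖) hs0
          (div_pos hπ hr) (by linarith)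
        rw [← mul_div_assoc, le_div_iff₀ hr] at this
        linarith }

/-- Outside an event of probability at most `10 C / s²`, both covariance estimators are within
`26 s⁵ p K / √n` of the population covariance in Frobenius norm. -/
theorem measureReal_frobNorm_le (hn : 2 ≤ n) (hK : 1 ≤ K)
    (hA : ConditionA P B S0 f y fs ys) (h : MomentBounds P B f y C σ) {s : ℝ}
    (hCs : C ≤ s) (hσs : C / σ ≤ s) (hσs2 : 2 / σ ≤ s) {S : Set Ω}
    (hS : ∀ ω ∈ S, 26 * s ^ 5 * ((n : ℝ) ^ (-(1 / 2) : ℝ) * p * K)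
        < frobNorm (factorCov (dataMatrix fs ω) (dataMatrix ys ω) - covMat P y) ∨
      26 * s ^ 5 * ((n : ℝ) ^ (-(1 / 2) : ℝ) * p * K)
        < frobNorm (sampleCov (dataMatrix ys ω) - covMat P y)) :
    P.real S ≤ 10 * C / s ^ 2 := by
  have hs : 1 ≤ s := h.one_le.trans hCs
  have hn0 : (0 : ℝ) < n := by exact_mod_cast (by omega : 0 < n)
  have hK0 : (0 : ℝ) < K := by exact_mod_cast hK
  have hp0 : (0 : ℝ) < p := by exact_mod_cast hK.trans hA.le
  have hκ : 0 < Real.sqrt K := Real.sqrt_pos.2 hK0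
  have hπ : 0 < Real.sqrt p := Real.sqrt_pos.2 hp0
  have hκK : Real.sqrt K ^ 2 = K := Real.sq_sqrt hK0.le
  have hπp : Real.sqrt p ^ 2 = p := Real.sq_sqrt hp0.le
  set r : ℝ := (n : ℝ) ^ (-(1 / 2) : ℝ) with hrdef
  have hr : 0 < r := Real.rpow_pos_of_pos hn0 _
  have hrn : r ^ 2 = (n : ℝ)⁻¹ := by
    rw [hrdef, ← Real.rpow_natCast, ← Real.rpow_mul hn0.le, ← Real.rpow_neg_one]
    norm_num
  obtain ⟨hint, hle⟩ := integral_discrepancy_le (by omega) hA h hκ hπ hr hκK hπp hrn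
  have hmarkov := mul_meas_ge_le_integral_of_nonneg
    (ae_of_all _ fun ω => discrepancy_nonneg) hint (s ^ 2)
  rw [le_div_iff₀ (by positivity), mul_comm]
  -- S need not be measurable: it is contained in the Markov event {s² ≤ discrepancy}, and
  -- monotonicity suffices.
  refine le_trans (mul_le_mul_of_nonneg_left (measureReal_mono fun ω hω => ?_) (by positivity))
    (hmarkov.trans hle)
  by_contra hlt
  have ht := typicalSample_of_discrepancy_le hn hK hA h hκ hπ hr hκK hπp hrn hCs hσs
    (not_le.1 hlt).le
  have hcov := covMat_eq_secondMoment_sub fun i => memLp_two_of_four (h.memLp_f i)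
  have hcovy := hA.covMat_y_eq h.memLp_f h.memLp_err
  have b1 := ht.norm_sampleCov_Y_sub_le
  have b2 := ht.norm_factorCov_sub_le hA.diag h.pos
    (hσs2.trans (le_self_pow₀ hs (by norm_num)))
    fun v => by
      rw [← hcov]
      exact le_dotProduct_mulVec_of_le_lam (covMat_isHermitian P f) h.eig_lower v
  rw [← hcov, ← hcovy, mul_dataMatrix_add_errMatrix, ← frobNorm_eq_norm, hπp, hκK] at b1 b2
  have hpos : 0 ≤ (p : ℝ) * K * r := by positivity
  have e : r * p * K = p * K * r := by ring
  have h45 : s ^ 4 ≤ s ^ 5 := pow_le_pow_right₀ hs (by norm_num)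
  have c1 : 26 * s ^ 4 * ((p : ℝ) * K * r) ≤ 26 * s ^ 5 * (p * K * r) := by gcongr
  have c2 : 18 * s ^ 5 * ((p : ℝ) * K * r) ≤ 26 * s ^ 5 * (p * K * r) := by
    gcongr; norm_num
  rcases hS ω hω with h1 | h1 <;> rw [e] at h1 <;> linarith

end Concentration

/-! ### Stochastic orders along the sequence of models. -/

section Asymptotics

variable {Ω : ℕ → Type*} [∀ n, MeasurableSpace (Ω n)] {P : ∀ n, Measure (Ω n)}

theorem ConditionB.exists_momentBounds {p K : ℕ → ℕ}
    {B : ∀ n, Matrix (Fin (p n)) (Fin (K n)) ℝ}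
    {f : ∀ n, Ω n → Fin (K n) → ℝ} {y : ∀ n, Ω n → Fin (p n) → ℝ} (hB : ConditionB P B f y) :
    ∃ C σ : ℝ, ∀ᶠ n in atTop, MomentBounds (P n) (B n) (f n) (y n) C σ := by
  obtain ⟨C₁, h₁⟩ := hB.c_bdd
  obtain ⟨C₂, h₂⟩ := hB.d_bdd
  obtain ⟨C₃, h₃⟩ := hB.b_bigO.bound
  obtain ⟨σ, hσ, h₄⟩ := hB.eig_lower
  -- One constant dominates all the bounds, and the entry 1 secures 1 ≤ C. The bound on E‖y‖² holds
  -- only eventually, and so does the conclusion.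
  refine ⟨max (max C₁ C₂) (max C₃ 1), σ, ?_⟩
  filter_upwards [h₃] with n hn
  exact
    { one_le := (le_max_right _ _).trans (le_max_right _ _)
      pos := hσ
      memLp_f := hB.memLp_f n
      memLp_err := hB.memLp_err n
      moment_f := fun i => (le_ciSup (f := fun i => ∫ ω, (f n ω i) ^ 4 ∂(P n))
        (Set.finite_range _).bddAbove i).trans
          ((h₁ ⟨n, rfl⟩).trans ((le_max_left _ _).trans (le_max_left _ _)))
      moment_err := fun i => (le_ciSup
        (f := fun i => ∫ ω, (err (B n) (f n) (y n) ω i) ^ 4 ∂(P n))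
        (Set.finite_range _).bddAbove i).trans
          ((h₂ ⟨n, rfl⟩).trans ((le_max_right _ _).trans (le_max_left _ _)))
      moment_y := by
        rw [Real.norm_natCast] at hn
        refine (le_abs_self _).trans (hn.trans ?_)
        gcongr
        exact (le_max_left _ _).trans (le_max_right _ _)
      eig_lower := h₄ n }

/-- The right-hand rate is √(log n) times the left-hand one, so the threshold in n does not depend
on p and K. -/
theorem eventually_mul_rate_le (p K : ℕ → ℕ) (M : ℝ) {ε : ℝ} (hε : 0 < ε) :
    ∀ᶠ n : ℕ in atTop, M * ((n : ℝ) ^ (-(1 / 2) : ℝ) * (p n : ℝ) * (K n : ℝ))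
      ≤ ε * Real.sqrt ((p n : ℝ) ^ 2 * (K n : ℝ) ^ 2 * Real.log n / n) := by
  have hlog : Tendsto (fun n : ℕ => Real.sqrt (Real.log n)) atTop atTop :=
    Real.tendsto_sqrt_atTop.comp (Real.tendsto_log_atTop.comp tendsto_natCast_atTop_atTop)
  filter_upwards [hlog.eventually_ge_atTop (M / ε), eventually_ge_atTop 1] with n hn h1
  have hn0 : (0 : ℝ) < n := by exact_mod_cast h1
  have e : Real.sqrt ((p n : ℝ) ^ 2 * (K n : ℝ) ^ 2 * Real.log n / n)
      = Real.sqrt (Real.log n) * ((n : ℝ) ^ (-(1 / 2) : ℝ) * (p n : ℝ) * (K n : ℝ)) := by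
    rw [← mul_pow, Real.sqrt_div' _ hn0.le, Real.sqrt_mul (by positivity),
      Real.sqrt_sq (by positivity), Real.rpow_neg hn0.le, ← Real.sqrt_eq_rpow]
    ring
  rw [div_le_iff₀ hε] at hn
  rw [e, ← mul_assoc ε]
  exact mul_le_mul_of_nonneg_right (by linarith) (by positivity)

theorem IsBigOP.isLittleOP_of_le [∀ n, IsProbabilityMeasure (P n)] {X X' : ∀ n, Ω n → ℝ}
    {r r' : ℕ → ℝ} (hX : IsBigOP P X r) (hle : ∀ n ω, |X' n ω| ≤ |X n ω|)
    (hr : ∀ M ε : ℝ, 0 < ε → ∀ᶠ n in atTop, M * r n ≤ ε * r' n) : IsLittleOP P X' r' := by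
  intro ε hε
  refine (tendsto_order.2 ⟨fun a ha => Eventually.of_forall fun n =>
    ha.trans_le measureReal_nonneg, fun a ha => ?_⟩)
  obtain ⟨M, -, hM⟩ := hX a ha
  filter_upwards [hM, hr M ε hε] with n h1 h2
  exact (measureReal_mono fun ω hω => (h2.trans_lt hω).trans_le (hle n ω)).trans_lt h1

end Asymptotics

end FactorCov

end

theorem theorem1 {Ω : ℕ → Type*} [∀ n, MeasurableSpace (Ω n)]
    (P : ∀ n, Measure (Ω n)) [∀ n, IsProbabilityMeasure (P n)]
    (p K : ℕ → ℕ) (hK : ∀ n, 1 ≤ K n)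
    (B : ∀ n, Matrix (Fin (p n)) (Fin (K n)) ℝ)
    (S0 : ∀ n, Matrix (Fin (p n)) (Fin (p n)) ℝ)
    (f : ∀ n, Ω n → Fin (K n) → ℝ) (y : ∀ n, Ω n → Fin (p n) → ℝ)
    (fs : ∀ n, Fin n → Ω n → Fin (K n) → ℝ) (ys : ∀ n, Fin n → Ω n → Fin (p n) → ℝ)
    (hA : ∀ n, FactorCov.ConditionA (P n) (B n) (S0 n) (f n) (y n) (fs n) (ys n))
    (hB : FactorCov.ConditionB P B f y) :
    FactorCov.IsBigOP P
      (fun n ω => FactorCov.frobNorm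
        (FactorCov.factorCov (FactorCov.dataMatrix (fs n) ω) (FactorCov.dataMatrix (ys n) ω)
          - FactorCov.covMat (P n) (y n)))
      (fun n => (n : ℝ) ^ (-(1 / 2) : ℝ) * (p n : ℝ) * (K n : ℝ)) ∧
    FactorCov.IsBigOP P
      (fun n ω => FactorCov.frobNorm
        (FactorCov.sampleCov (FactorCov.dataMatrix (ys n) ω) - FactorCov.covMat (P n) (y n)))
      (fun n => (n : ℝ) ^ (-(1 / 2) : ℝ) * (p n : ℝ) * (K n : ℝ)) ∧
    FactorCov.IsLittleOP P
      (fun n ω => FactorCov.maxEigDist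
        (FactorCov.factorCov_isHermitian
          (FactorCov.dataMatrix (fs n) ω) (FactorCov.dataMatrix (ys n) ω))
        (FactorCov.covMat_isHermitian (P n) (y n)))
      (fun n => Real.sqrt ((p n : ℝ) ^ 2 * (K n : ℝ) ^ 2 * Real.log n / n)) ∧
    FactorCov.IsLittleOP P
      (fun n ω => FactorCov.maxEigDist
        (FactorCov.sampleCov_isHermitian (FactorCov.dataMatrix (ys n) ω))
        (FactorCov.covMat_isHermitian (P n) (y n)))
      (fun n => Real.sqrt ((p n : ℝ) ^ 2 * (K n : ℝ) ^ 2 * Real.log n / n)) := by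
  obtain ⟨C, σ, hC⟩ := hB.exists_momentBounds
  -- One exceptional event serves both estimators; S ranges over arbitrary sets.
  have key : ∀ ε : ℝ, 0 < ε → ∃ M : ℝ, 0 < M ∧ ∀ᶠ n in atTop, ∀ S : Set (Ω n),
      (∀ ω ∈ S, M * ((n : ℝ) ^ (-(1 / 2) : ℝ) * p n * K n) < FactorCov.frobNorm
          (FactorCov.factorCov (FactorCov.dataMatrix (fs n) ω) (FactorCov.dataMatrix (ys n) ω)
            - FactorCov.covMat (P n) (y n)) ∨
        M * ((n : ℝ) ^ (-(1 / 2) : ℝ) * p n * K n) < FactorCov.frobNorm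
          (FactorCov.sampleCov (FactorCov.dataMatrix (ys n) ω)
            - FactorCov.covMat (P n) (y n))) → (P n).real S < ε := by
    intro ε hε
    have hlim : Tendsto (fun s : ℝ => 10 * C / s ^ 2) atTop (nhds 0) :=
      tendsto_const_nhds.div_atTop (tendsto_pow_atTop two_ne_zero)
    obtain ⟨s, h1, h2, h3, h4, h5⟩ := ((hlim.eventually_lt_const hε).and
      ((eventually_ge_atTop C).and ((eventually_ge_atTop (C / σ)).and
        ((eventually_ge_atTop (2 / σ)).and (eventually_gt_atTop 0))))).exists
    refine ⟨26 * s ^ 5, by positivity, ?_⟩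
    filter_upwards [hC, eventually_ge_atTop 2] with n hn hn2 S hS
    exact (FactorCov.measureReal_frobNorm_le hn2 (hK n) (hA n) hn h2 h3 h4 hS).trans_lt h1
  have nonneg : ∀ {q : ℕ} (A : Matrix (Fin q) (Fin q) ℝ), 0 ≤ FactorCov.frobNorm A :=
    fun A => Real.sqrt_nonneg _
  have hfac : FactorCov.IsBigOP P
      (fun n ω => FactorCov.frobNorm
        (FactorCov.factorCov (FactorCov.dataMatrix (fs n) ω) (FactorCov.dataMatrix (ys n) ω)
          - FactorCov.covMat (P n) (y n)))
      (fun n => (n : ℝ) ^ (-(1 / 2) : ℝ) * (p n : ℝ) * (K n : ℝ)) := fun ε hε => by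
    obtain ⟨M, hM, h⟩ := key ε hε
    refine ⟨M, hM, h.mono fun n hn => hn _ fun ω hω => Or.inl ?_⟩
    simpa only [Set.mem_ofPred_eq, abs_of_nonneg (nonneg _)] using hω
  have hsam : FactorCov.IsBigOP P
      (fun n ω => FactorCov.frobNorm
        (FactorCov.sampleCov (FactorCov.dataMatrix (ys n) ω) - FactorCov.covMat (P n) (y n)))
      (fun n => (n : ℝ) ^ (-(1 / 2) : ℝ) * (p n : ℝ) * (K n : ℝ)) := fun ε hε => by
    obtain ⟨M, hM, h⟩ := key ε hε
    refine ⟨M, hM, h.mono fun n hn => hn _ fun ω hω => Or.inr ?_⟩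
    simpa only [Set.mem_ofPred_eq, abs_of_nonneg (nonneg _)] using hω
  refine ⟨hfac, hsam,
    hfac.isLittleOP_of_le (fun n ω => ?_) fun M ε hε => FactorCov.eventually_mul_rate_le p K M hε,
    hsam.isLittleOP_of_le (fun n ω => ?_) fun M ε hε => FactorCov.eventually_mul_rate_le p K M hε⟩
  all_goals
    rw [abs_of_nonneg (FactorCov.maxEigDist_nonneg _ _), abs_of_nonneg (nonneg _)]
    exact FactorCov.maxEigDist_le _ _
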